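/- Let $n\ge 1$ and let $\{A(t)\}_{t\ge 0}$ be a continuous-time stochastic chain on $[n]=\{1,\dots,n\}$, i.e. $A(t)=(a_{ij}(t))\in\mathbb R^{n\times n}$ is, for every $t\ge 0$, the negative of the Laplacian of a weighted directed graph with nonnegative weights (so $a_{ij}(t)\ge 0$ for $i\ne j$ and $a_{ii}(t)=-\sum_{j\ne i}a_{ij}(t)$), with every $a_{ij}$ integrable on every bounded interval $[s_1,s_2]\subset[0,\infty)$. Suppose that there are a constant $M<\infty$ and a strictly increasing sequence $\{t_k\}_{k\ge 0}\subset[0,\infty)$ with $t_k\to\infty$ such that $$\int_{t_k}^{t_{k+1}}a_{ij}(t)\,dt\le M\qquad\text{for all }k\ge 1\text{ and all }i\ne j .$$ Let $\Phi(t,\tau)$, $t\ge\tau\ge 0$, be the state-transition matrix of $\dot x(t)=A(t)x(t)$, i.e. the unique solution of $\Phi(t,\tau)=I+\int_\tau^t A(s)\Phi(s,\tau)\,ds$ for all $t\ge\tau\ge 0$. Then the following are equivalent. 1. The chain has a uniformly positive absolute probability sequence: there are stochastic vectors $\{\pi(t)\}_{t\ge 0}\subset\mathbb R^n$ with $\pi^T(t)\Phi(t,\tau)=\pi^T(\tau)$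 for all $t\ge\tau\ge 0$, and a constant $p^*>0$ with $\pi_i(t)\ge p^*$ for all $t\ge 0$ and all $i\in[n]$. 2. The chain is approximately reciprocal: there are constants $p_0,\beta\in(0,\infty)$ such that $$p_0\int_{t_\ell}^{t_m}\sum_{i\in S}\sum_{j\in [n]\setminus S}a_{ij}(t)\,dt\ \le\ \int_{t_\ell}^{t_m}\sum_{i\in [n]\setminus S}\sum_{j\in S}a_{ij}(t)\,dt+\beta$$ for all $S\subset[n]$ and all integers $0\le\ell\le m$, with the same sequence $\{t_k\}$ as above. -/

import Mathlib

open scoped Matrix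

/-- The weighted Laplacian of the graph with edge weights `W`: off-diagonal entries `-w i j`,
diagonal entries `∑ j ≠ i, w i j`. -/
def weightedLaplacian {n : ℕ} (W : Matrix (Fin n) (Fin n) ℝ) : Matrix (Fin n) (Fin n) ℝ :=
  Matrix.of fun i j => if i = j then ∑ k ∈ Finset.univ.erase i, W i k else -W i j

/-- A continuous-time stochastic chain: at each time `s ≥ 0` the matrix `A s` is the negative of the
Laplacian of a graph with nonnegative weights, and all entries are integrable on bounded time
intervals. Values at negative times play no role. -/
structure IsContinuousTimeStochasticChain {n : ℕ} (A : ℝ → Matrix (Fin n) (Fin n) ℝ) : Prop where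
  neg_laplacian : ∀ s, 0 ≤ s →
    ∃ W : Matrix (Fin n) (Fin n) ℝ, (∀ i j, 0 ≤ W i j) ∧ A s = -weightedLaplacian W
  integrable : ∀ i j s₁ s₂, 0 ≤ s₁ → s₁ < s₂ →
    IntervalIntegrable (fun s => A s i j) MeasureTheory.volume s₁ s₂

/-- `Φ` is the state-transition matrix of `ẋ = A x`: it solves
`Φ(t, τ) = I + ∫_τ^t A(s) Φ(s, τ) ds` for all `t ≥ τ ≥ 0`, the integrals being taken entrywise and
required to exist. -/
def IsStateTransitionMatrix {n : ℕ} (A : ℝ → Matrix (Fin n) (Fin n) ℝ)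
    (Φ : ℝ → ℝ → Matrix (Fin n) (Fin n) ℝ) : Prop :=
  ∀ t τ, 0 ≤ τ → τ ≤ t → ∀ i j,
    IntervalIntegrable (fun s => (A s * Φ s τ) i j) MeasureTheory.volume τ t ∧
    Φ t τ i j = (1 : Matrix (Fin n) (Fin n) ℝ) i j + ∫ s in τ..t, (A s * Φ s τ) i j

/-- `π` is an absolute probability sequence relative to the state-transition matrix `Φ`: each `π t`
is a stochastic vector and `π(t)ᵀ Φ(t, τ) = π(τ)ᵀ` for all `t ≥ τ ≥ 0`. -/
structure IsAbsoluteProbabilitySequence {n : ℕ} (Φ : ℝ → ℝ → Matrix (Fin n) (Fin n) ℝ)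
    (π : ℝ → Fin n → ℝ) : Prop where
  stochastic : ∀ t, 0 ≤ t → π t ∈ stdSimplex ℝ (Fin n)
  invariant : ∀ t τ, 0 ≤ τ → τ ≤ t → π t ᵥ* Φ t τ = π τ

/-- The chain `A` has a uniformly positive absolute probability sequence. -/
def HasUniformlyPositiveAbsoluteProbabilitySequence {n : ℕ}
    (A : ℝ → Matrix (Fin n) (Fin n) ℝ) : Prop :=
  ∃ Φ : ℝ → ℝ → Matrix (Fin n) (Fin n) ℝ, IsStateTransitionMatrix A Φ ∧
    ∃ π : ℝ → Fin n → ℝ, IsAbsoluteProbabilitySequence Φ π ∧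
      ∃ p : ℝ, 0 < p ∧ ∀ t, 0 ≤ t → ∀ i, p ≤ π t i

/-- `1ᵀ B_{S S̄} 1`, the sum of the entries of `B` with row in `S` and column outside `S`. -/
def cutSum {n : ℕ} (B : Matrix (Fin n) (Fin n) ℝ) (S : Finset (Fin n)) : ℝ :=
  ∑ i ∈ S, ∑ j ∈ Sᶜ, B i j

/-- The uniform bound on integral weights along the sequence of times `t`: the times are
nonnegative, increase to infinity, and the off-diagonal weights have integrals over the intervals
`[t k, t (k + 1)]`, `k ≥ 1`, bounded by one constant. -/
structure UniformBoundOnIntegralWeights {n : ℕ} (A : ℝ → Matrix (Fin n) (Fin n) ℝ)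
    (t : ℕ → ℝ) : Prop where
  nonneg : ∀ k, 0 ≤ t k
  strictMono : StrictMono t
  tendsto : Filter.Tendsto t Filter.atTop Filter.atTop
  bound : ∃ M : ℝ, ∀ k, 1 ≤ k → ∀ i j, i ≠ j → ∫ s in t k..t (k + 1), A s i j ≤ M

/-- Approximate reciprocity of the chain `A` along the sequence of times `t`. -/
def IsApproximatelyReciprocal {n : ℕ} (A : ℝ → Matrix (Fin n) (Fin n) ℝ) (t : ℕ → ℝ) : Prop :=
  ∃ p₀ β : ℝ, 0 < p₀ ∧ 0 < β ∧ ∀ (S : Finset (Fin n)) (l m : ℕ), l ≤ m →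
    p₀ * ∫ s in t l..t m, cutSum (A s) S ≤ (∫ s in t l..t m, cutSum (A s) Sᶜ) + β

/-!
The transition matrices `B k = Φ (t (k + 1)) (t k)` turn the chain into a discrete one. With a
bound `K` on the integral weights they are row-stochastic with diagonal at least `exp (-n K)`
(`IsStateTransitionMatrix.exp_le_diag`), and for every `S` the weight of `B k` leaving `S` is
comparable, up to constants, to the integral of the weight of `A` leaving `S`
(`IsStateTransitionMatrix.exp_mul_integral_cutSum_le`, `IsStateTransitionMatrix.cutSum_le`). So
approximate reciprocity of `A` and of `B` are the same thing.

If `π` is an absolute probability sequence with entries at least `p`, then over one interval `p` times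
the weight leaving `S` is at most the weight entering `S` plus the increment of `∑ i ∈ S, π i`
(`IsAbsoluteProbabilitySequence.mul_cutSum_le`). Summed over the intervals, the increments telescope
to at most `1`, which is approximate reciprocity.

For the converse it suffices to bound the column sums of `Φ (t m) (t l)` below, uniformly in `l ≤ m`:
the uniform distribution at time `t m`, evolved backward, then has a uniformly positive limit as
`m → ∞` along an ultrafilter. The column sum at `j` is the total of the solution of
`x (k + 1) = B k *ᵥ x k` started at the `j`-th unit vector. It is bounded below by
`exists_uniform_mass_bound`, by induction on the number of indices. Let `x` be large on a set `S` of
indices. As long as the total weight leaving `S` is bounded, `x` stays large on `S`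
(`IsSupersolutionOn.persist`). Once that weight exceeds `(β + 1) / p₀`, reciprocity forces the weight
entering `S` to be at least `1`, while all weights between `S` and its complement are still bounded in
total. Therefore the chain restricted to the complement is again approximately reciprocal
(`IsReciprocalOn.sdiff`), and by the induction hypothesis it retains a fixed fraction of the mass that
it has received from `S` (`sum_injection_le`). Hence `x` is large at some index outside `S`, and `S`
can be enlarged, which happens fewer than `n` times.

Since the coefficients are only integrable in time, existence of `Φ`
(`exists_linear_solution`), positivity and comparison (`nonneg_of_supersolution`) are derived from
calculus for absolutely continuous functions.
-/

/-! ### Approximately reciprocal discrete chains -/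

/-- The total weight `∑ i ∈ S, ∑ j ∈ T, B i j` of the entries of `B` with row in `S` and column
in `T`. -/
def blockSum {ι : Type*} (B : Matrix ι ι ℝ) (S T : Finset ι) : ℝ :=
  ∑ i ∈ S, ∑ j ∈ T, B i j

/-- The matrices `B l, …, B (m - 1)`, restricted to the index set `U`, form a discrete chain of
substochastic matrices with diagonal at least `γ`, which are approximately reciprocal with constants
`p₀` and `β`, and whose row sums over `U` miss `1` by at most `D` in total. The defect `D` makes the
notion stable under passing to a smaller index set. -/
structure IsReciprocalOn {ι : Type*} [DecidableEq ι] (p₀ γ β D : ℝ) (B : ℕ → Matrix ι ι ℝ)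
    (U : Finset ι) (l m : ℕ) : Prop where
  nonneg : ∀ k i j, 0 ≤ B k i j
  diag : ∀ k ∈ Finset.Ico l m, ∀ i ∈ U, γ ≤ B k i i
  row_le : ∀ k ∈ Finset.Ico l m, ∀ i ∈ U, ∑ j ∈ U, B k i j ≤ 1
  defect : ∑ k ∈ Finset.Ico l m, ∑ i ∈ U, (1 - ∑ j ∈ U, B k i j) ≤ D
  reciprocal : ∀ S ⊆ U, ∀ r s, l ≤ r → r ≤ s → s ≤ m →
    p₀ * ∑ k ∈ Finset.Ico r s, blockSum (B k) S (U \ S) ≤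
      ∑ k ∈ Finset.Ico r s, blockSum (B k) (U \ S) S + β

/-- `x` is nonnegative and satisfies `x (k + 1) ≥ B k *ᵥ x k` on `U`, for `l ≤ k < m`. -/
structure IsSupersolutionOn {ι : Type*} (B : ℕ → Matrix ι ι ℝ) (U : Finset ι) (l m : ℕ)
    (x : ℕ → ι → ℝ) : Prop where
  nonneg : ∀ k i, 0 ≤ x k i
  le_succ : ∀ k ∈ Finset.Ico l m, ∀ i ∈ U, ∑ j ∈ U, B k i j * x k j ≤ x (k + 1) i

lemma blockSum_nonneg {ι : Type*} {B : Matrix ι ι ℝ} (hB : ∀ i j, 0 ≤ B i j) (S T : Finset ι) :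
    0 ≤ blockSum B S T :=
  Finset.sum_nonneg fun i _ => Finset.sum_nonneg fun j _ => hB i j

lemma blockSum_mono {ι : Type*} {B : Matrix ι ι ℝ} (hB : ∀ i j, 0 ≤ B i j) {S S' T T' : Finset ι}
    (hS : S ⊆ S') (hT : T ⊆ T') : blockSum B S T ≤ blockSum B S' T' :=
  (Finset.sum_le_sum fun i _ =>
    Finset.sum_le_sum_of_subset_of_nonneg hT fun j _ _ => hB i j).trans
    (Finset.sum_le_sum_of_subset_of_nonneg hS fun i _ _ => Finset.sum_nonneg fun j _ => hB i j)

lemma IsSupersolutionOn.mono_window {ι : Type*} {B : ℕ → Matrix ι ι ℝ} {U : Finset ι} {l m : ℕ}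
    {x : ℕ → ι → ℝ} (h : IsSupersolutionOn B U l m x) {r s : ℕ} (hr : l ≤ r)
    (hs : s ≤ m) : IsSupersolutionOn B U r s x :=
  ⟨h.nonneg, fun k hk => h.le_succ k (Finset.Ico_subset_Ico hr hs hk)⟩

section

variable {ι : Type*} [DecidableEq ι] {p₀ γ β D : ℝ} {B : ℕ → Matrix ι ι ℝ} {U S : Finset ι}
  {l m : ℕ} {x : ℕ → ι → ℝ}

lemma IsReciprocalOn.mono_window (h : IsReciprocalOn p₀ γ β D B U l m) {r s : ℕ} (hr : l ≤ r)
    (hs : s ≤ m) : IsReciprocalOn p₀ γ β D B U r s := by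
  have hsub : Finset.Ico r s ⊆ Finset.Ico l m := Finset.Ico_subset_Ico hr hs
  refine ⟨h.nonneg, fun k hk => h.diag k (hsub hk), fun k hk => h.row_le k (hsub hk), ?_,
    fun S hS a b ha hab hb => h.reciprocal S hS a b (hr.trans ha) hab (hb.trans hs)⟩
  refine le_trans (Finset.sum_le_sum_of_subset_of_nonneg hsub fun k hk _ => ?_) h.defect
  exact Finset.sum_nonneg fun i hi => sub_nonneg.2 (h.row_le k hk i hi)

lemma IsReciprocalOn.blockSum_le_card (h : IsReciprocalOn p₀ γ β D B U l m) (hS : S ⊆ U) {k : ℕ}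
    (hk : k ∈ Finset.Ico l m) : blockSum (B k) S (U \ S) ≤ U.card := by
  have h1 : blockSum (B k) S (U \ S) ≤ blockSum (B k) U U :=
    blockSum_mono (h.nonneg k) hS Finset.sdiff_subset
  refine h1.trans ?_
  calc blockSum (B k) U U ≤ ∑ i ∈ U, (1 : ℝ) := Finset.sum_le_sum fun i hi => h.row_le k hk i hi
    _ = U.card := by simp

/-- While the total weight leaving `S` is at most `C`, the values on `S` decrease at most by the factor
`exp (-(D + C) / γ)`. -/
lemma IsSupersolutionOn.persist (hγ : 0 < γ) (h : IsReciprocalOn p₀ γ β D B U l m)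
    (hx : IsSupersolutionOn B U l m x) (hS : S ⊆ U) {δ C : ℝ} (hδ : 0 ≤ δ)
    (hxS : ∀ i ∈ S, δ ≤ x l i)
    (hC : ∑ k ∈ Finset.Ico l m, blockSum (B k) S (U \ S) ≤ C) {r : ℕ} (hlr : l ≤ r) (hrm : r ≤ m) :
    ∀ i ∈ S, δ * Real.exp (-((D + C) / γ)) ≤ x r i := by
  set F : ℕ → ℝ := fun k => ∑ i ∈ U, (1 - ∑ j ∈ U, B k i j) + blockSum (B k) S (U \ S) with hF
  have hF0 : ∀ k ∈ Finset.Ico l m, 0 ≤ F k := fun k hk =>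
    add_nonneg (Finset.sum_nonneg fun i hi => sub_nonneg.2 (h.row_le k hk i hi))
      (blockSum_nonneg (h.nonneg k) _ _)
  have key : ∀ r, l ≤ r → r ≤ m → ∀ i ∈ S,
      δ * Real.exp (-((∑ k ∈ Finset.Ico l r, F k) / γ)) ≤ x r i := by
    intro r hr
    induction r, hr using Nat.le_induction with
    | base => intro _ i hi; simpa using hxS i hi
    | succ r hr ih =>
      intro hrm i hi
      have hk : r ∈ Finset.Ico l m := Finset.mem_Ico.2 ⟨hr, hrm⟩
      have ih' := ih (by omega)
      set e := δ * Real.exp (-((∑ k ∈ Finset.Ico l r, F k) / γ)) with he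
      have he0 : 0 ≤ e := by positivity
      have h1 : (∑ j ∈ S, B r i j) * e ≤ x (r + 1) i := by
        refine le_trans ?_ (hx.le_succ r hk i (hS hi))
        rw [Finset.sum_mul]
        refine (Finset.sum_le_sum fun j hj =>
          mul_le_mul_of_nonneg_left (ih' j hj) (h.nonneg r i j)).trans ?_
        exact Finset.sum_le_sum_of_subset_of_nonneg hS fun j _ _ =>
          mul_nonneg (h.nonneg r i j) (hx.nonneg r j)
      set s := ∑ j ∈ S, B r i j with hs
      have hsγ : γ ≤ s := (h.diag r hk i (hS hi)).trans
        (Finset.single_le_sum (fun j _ => h.nonneg r i j) hi)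
      have hs0 : 0 < s := hγ.trans_le hsγ
      have hsF : 1 - s ≤ F r := by
        have e1 : 1 - ∑ j ∈ U, B r i j ≤ ∑ i ∈ U, (1 - ∑ j ∈ U, B r i j) :=
          Finset.single_le_sum (f := fun i => 1 - ∑ j ∈ U, B r i j)
            (fun i hi => sub_nonneg.2 (h.row_le r hk i hi)) (hS hi)
        have e2 : ∑ j ∈ U \ S, B r i j ≤ blockSum (B r) S (U \ S) :=
          Finset.single_le_sum (f := fun i => ∑ j ∈ U \ S, B r i j)
            (fun i _ => Finset.sum_nonneg fun j _ => h.nonneg r i j) hi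
        have e3 := Finset.sum_sdiff (f := fun j => B r i j) hS
        simp only [hF]
        linarith
      -- the row sum `s` over `S` satisfies `γ ≤ s` and `1 - s ≤ F r`, so `1 - s⁻¹ ≥ -F r / γ`
      have hexp : Real.exp (-(F r / γ)) ≤ s := by
        rw [← Real.le_log_iff_exp_le hs0]
        refine le_trans ?_ (Real.one_sub_inv_le_log_of_pos hs0)
        have h2 : s⁻¹ - 1 ≤ F r / γ := by
          rw [le_div_iff₀ hγ]
          have hF0' := hF0 r hk
          rcases le_total s 1 with h3 | h3
          · have h4 : 0 ≤ s⁻¹ - 1 := by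
              have := (one_le_inv₀ hs0).2 h3
              linarith
            calc (s⁻¹ - 1) * γ ≤ (s⁻¹ - 1) * s := mul_le_mul_of_nonneg_left hsγ h4
              _ = 1 - s := by field_simp
              _ ≤ F r := hsF
          · have h4 : s⁻¹ - 1 ≤ 0 := by
              have := inv_le_one_of_one_le₀ h3
              linarith
            exact (mul_nonpos_of_nonpos_of_nonneg h4 hγ.le).trans hF0'
        linarith
      calc δ * Real.exp (-((∑ k ∈ Finset.Ico l (r + 1), F k) / γ))
          = Real.exp (-(F r / γ)) * e := by
            rw [Finset.sum_Ico_succ_top hr, he, add_div, neg_add, Real.exp_add]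
            ring
        _ ≤ s * e := mul_le_mul_of_nonneg_right hexp he0
        _ ≤ _ := h1
  intro i hi
  refine le_trans ?_ (key r hlr hrm i hi)
  refine mul_le_mul_of_nonneg_left (Real.exp_le_exp.2 ?_) hδ
  have h5 : ∑ k ∈ Finset.Ico l r, F k ≤ D + C := by
    refine (Finset.sum_le_sum_of_subset_of_nonneg (Finset.Ico_subset_Ico le_rfl hrm)
      fun k hk _ => hF0 k hk).trans ?_
    simp only [hF, Finset.sum_add_distrib]
    exact add_le_add h.defect hC
  exact neg_le_neg (div_le_div_of_nonneg_right h5 hγ.le)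

/-- If the weights exchanged between `S` and `U \ S` are bounded in total, then the chain restricted
to `U \ S` is again approximately reciprocal, with worse constants. -/
lemma IsReciprocalOn.sdiff (hp : 0 < p₀) (h : IsReciprocalOn p₀ γ β D B U l m) (hlm : l ≤ m)
    (hS : S ⊆ U) {C : ℝ} (hC : ∑ k ∈ Finset.Ico l m, blockSum (B k) S (U \ S) ≤ C) :
    IsReciprocalOn p₀ γ (β + C) (D + (C + β) / p₀) B (U \ S) l m := by
  have hrow : ∀ k i, ∑ j ∈ U \ S, B k i j = ∑ j ∈ U, B k i j - ∑ j ∈ S, B k i j := fun k i => by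
    rw [← Finset.sum_sdiff hS]; ring
  refine ⟨h.nonneg, fun k hk i hi => h.diag k hk i (Finset.sdiff_subset hi), fun k hk i hi => ?_,
    ?_, fun W hW r s hlr hrs hsm => ?_⟩
  · exact (Finset.sum_le_sum_of_subset_of_nonneg Finset.sdiff_subset
      fun j _ _ => h.nonneg k i j).trans (h.row_le k hk i (Finset.sdiff_subset hi))
  · have hin := h.reciprocal (U \ S) Finset.sdiff_subset l m le_rfl hlm le_rfl
    rw [Finset.sdiff_sdiff_eq_self hS] at hin
    have hin' : ∑ k ∈ Finset.Ico l m, blockSum (B k) (U \ S) S ≤ (C + β) / p₀ := by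
      rw [le_div_iff₀ hp]
      linarith
    calc ∑ k ∈ Finset.Ico l m, ∑ i ∈ U \ S, (1 - ∑ j ∈ U \ S, B k i j)
        = ∑ k ∈ Finset.Ico l m, (∑ i ∈ U \ S, (1 - ∑ j ∈ U, B k i j)
            + blockSum (B k) (U \ S) S) := by
          refine Finset.sum_congr rfl fun k _ => ?_
          rw [blockSum, ← Finset.sum_add_distrib]
          exact Finset.sum_congr rfl fun i _ => by rw [hrow]; ring
      _ ≤ ∑ k ∈ Finset.Ico l m, (∑ i ∈ U, (1 - ∑ j ∈ U, B k i j)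
            + blockSum (B k) (U \ S) S) := by
          refine Finset.sum_le_sum fun k hk => add_le_add ?_ le_rfl
          exact Finset.sum_le_sum_of_subset_of_nonneg Finset.sdiff_subset
            fun i hi _ => sub_nonneg.2 (h.row_le k hk i hi)
      _ ≤ D + (C + β) / p₀ := by
          rw [Finset.sum_add_distrib]
          exact add_le_add h.defect hin'
  · have hWU : W ⊆ U := hW.trans Finset.sdiff_subset
    have h1 := h.reciprocal W hWU r s hlr hrs hsm
    have h2 : ∑ k ∈ Finset.Ico r s, blockSum (B k) W ((U \ S) \ W) ≤
        ∑ k ∈ Finset.Ico r s, blockSum (B k) W (U \ W) :=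
      Finset.sum_le_sum fun k _ => blockSum_mono (h.nonneg k) subset_rfl
        (Finset.sdiff_subset_sdiff Finset.sdiff_subset subset_rfl)
    have h3 : ∑ k ∈ Finset.Ico r s, blockSum (B k) (U \ W) W ≤
        ∑ k ∈ Finset.Ico r s, blockSum (B k) ((U \ S) \ W) W +
          ∑ k ∈ Finset.Ico r s, blockSum (B k) S (U \ S) := by
      rw [← Finset.sum_add_distrib]
      refine Finset.sum_le_sum fun k _ => ?_
      have hSW : S ⊆ U \ W := fun i hi => Finset.mem_sdiff.2
        ⟨hS hi, fun hiW => (Finset.mem_sdiff.1 (hW hiW)).2 hi⟩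
      have h4 : (U \ S) \ W = (U \ W) \ S := by
        ext i
        simp only [Finset.mem_sdiff]
        tauto
      have h5 : blockSum (B k) (U \ W) W = blockSum (B k) ((U \ S) \ W) W + blockSum (B k) S W := by
        rw [h4, blockSum, blockSum, blockSum, Finset.sum_sdiff hSW]
      rw [h5]
      exact add_le_add le_rfl (blockSum_mono (h.nonneg k) subset_rfl hW)
    have h6 : ∑ k ∈ Finset.Ico r s, blockSum (B k) S (U \ S) ≤ C :=
      (Finset.sum_le_sum_of_subset_of_nonneg (Finset.Ico_subset_Ico hlr hsm)
        fun k _ _ => blockSum_nonneg (h.nonneg k) _ _).trans hC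
    have h7 := mul_le_mul_of_nonneg_left h2 hp.le
    linarith

end

/-! ### Lower bound for the transported mass -/

lemma exists_forward_solution {ι : Type*} (B : ℕ → Matrix ι ι ℝ) (U : Finset ι) (k : ℕ)
    (v : ι → ℝ) : ∃ x : ℕ → ι → ℝ, x k = v ∧
      ∀ r, k ≤ r → ∀ i, x (r + 1) i = ∑ j ∈ U, B r i j * x r j := by
  let z : ℕ → ι → ℝ := fun s => Nat.rec v (fun s w i => ∑ j ∈ U, B (k + s) i j * w j) s
  refine ⟨fun r => z (r - k), by simp [z], fun r hr i => ?_⟩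
  obtain ⟨s, rfl⟩ := Nat.exists_eq_add_of_le hr
  have h1 : k + s + 1 - k = s + 1 := by omega
  have h2 : k + s - k = s := by omega
  simp only [h1, h2, z]

/-- The adjoint recursion, solved backward from the constant vector `1` at time `m`. -/
lemma exists_backward_solution {ι : Type*} (B : ℕ → Matrix ι ι ℝ) (U : Finset ι) (m : ℕ) :
    ∃ y : ℕ → ι → ℝ, (∀ i, y m i = 1) ∧
      ∀ k, k < m → ∀ j, y k j = ∑ i ∈ U, y (k + 1) i * B k i j := by
  let z : ℕ → ι → ℝ := fun s =>
    Nat.rec (fun _ => 1) (fun s w j => ∑ i ∈ U, w i * B (m - 1 - s) i j) s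
  refine ⟨fun k => z (m - k), by simp [z], fun k hk j => ?_⟩
  obtain ⟨s, rfl⟩ := Nat.exists_eq_add_of_lt hk
  have h1 : k + s + 1 - k = s + 1 := by omega
  have h2 : k + s + 1 - (k + 1) = s := by omega
  have h3 : k + s + 1 - 1 - s = k := by omega
  simp only [h1, h2, z, h3]

/-- Superposition: if mass placed at one time on one index of `U` keeps at least the fraction `c`
until time `m`, then so does mass `g k i` injected at all times. The proof pairs `x` with the
solution of the adjoint recursion that ends in the constant vector `1`. -/
lemma sum_injection_le {ι : Type*} [DecidableEq ι] {B : ℕ → Matrix ι ι ℝ} {U : Finset ι}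
    {l m : ℕ} {c : ℝ} (hB : ∀ k i j, 0 ≤ B k i j) (hlm : l ≤ m)
    (hc : ∀ k, l ≤ k → k ≤ m → ∀ x, IsSupersolutionOn B U k m x →
      ∀ j ∈ U, c * x k j ≤ ∑ i ∈ U, x m i)
    {x g : ℕ → ι → ℝ} (hx0 : ∀ k i, 0 ≤ x k i) (hg : ∀ k i, 0 ≤ g k i)
    (hx : ∀ k ∈ Finset.Ico l m, ∀ i ∈ U, ∑ j ∈ U, B k i j * x k j + g k i ≤ x (k + 1) i) :
    c * ∑ k ∈ Finset.Ico l m, ∑ i ∈ U, g k i ≤ ∑ i ∈ U, x m i := by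
  obtain ⟨y, hym, hy⟩ := exists_backward_solution B U m
  have hy0 : ∀ k, k ≤ m → ∀ i, 0 ≤ y k i := by
    intro k hk
    induction hk using Nat.decreasingInduction with
    | self => intro i; simp [hym]
    | of_succ k hk ih =>
      intro i
      rw [hy k hk]
      exact Finset.sum_nonneg fun j _ => mul_nonneg (ih j) (hB k j i)
  have hpair : ∀ k, k < m → ∀ v : ι → ℝ,
      ∑ i ∈ U, y (k + 1) i * ∑ j ∈ U, B k i j * v j = ∑ j ∈ U, y k j * v j := by
    intro k hk v
    simp_rw [hy k hk, Finset.mul_sum, Finset.sum_mul]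
    rw [Finset.sum_comm]
    exact Finset.sum_congr rfl fun j _ => Finset.sum_congr rfl fun i _ => by ring
  have hyc : ∀ k, l ≤ k → k ≤ m → ∀ j ∈ U, c ≤ y k j := by
    intro k hlk hkm j hj
    obtain ⟨z, hzk, hz⟩ := exists_forward_solution B U k (Pi.single j 1)
    have hz0 : ∀ r, k ≤ r → ∀ i, 0 ≤ z r i := by
      intro r hr
      induction r, hr using Nat.le_induction with
      | base =>
        intro i
        rw [hzk, Pi.single_apply]
        split_ifs <;> norm_num
      | succ r hr ih =>
        intro i
        rw [hz r hr]
        exact Finset.sum_nonneg fun j _ => mul_nonneg (hB r i j) (ih j)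
    have hconst : ∀ r, k ≤ r → r ≤ m → ∑ i ∈ U, y r i * z r i = y k j := by
      intro r hr
      induction r, hr using Nat.le_induction with
      | base =>
        intro _
        rw [hzk]
        simp [Pi.single_apply, hj]
      | succ r hr ih =>
        intro hrm
        rw [← ih (by omega), ← hpair r (by omega)]
        exact Finset.sum_congr rfl fun i _ => by rw [hz r hr]
    -- before time `k` the values of the solution are irrelevant, and are replaced by `0`
    have hsup : IsSupersolutionOn B U k m (fun r => if k ≤ r then z r else 0) := by
      refine ⟨fun r i => ?_, fun r hr i _ => ?_⟩
      · by_cases h : k ≤ r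
        · simpa [h] using hz0 r h i
        · simp [h]
      · have h1 : k ≤ r := (Finset.mem_Ico.1 hr).1
        have h2 : k ≤ r + 1 := by omega
        simp only [h1, h2, if_true]
        exact (hz r h1 i).ge
    have h3 := hc k hlk hkm _ hsup j hj
    have h4 := hconst m hkm le_rfl
    simp only [hym, one_mul] at h4
    simp only [le_refl, if_true, hkm, h4, hzk, Pi.single_eq_same, mul_one] at h3
    exact h3
  have key : ∀ r, l ≤ r → r ≤ m →
      c * ∑ k ∈ Finset.Ico l r, ∑ i ∈ U, g k i ≤ ∑ i ∈ U, y r i * x r i := by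
    intro r hr
    induction r, hr using Nat.le_induction with
    | base =>
      intro h
      simpa using Finset.sum_nonneg fun i _ => mul_nonneg (hy0 l h i) (hx0 l i)
    | succ r hr ih =>
      intro hrm
      have h1 := ih (by omega)
      rw [← hpair r (by omega)] at h1
      have h2 : c * ∑ i ∈ U, g r i ≤ ∑ i ∈ U, y (r + 1) i * g r i := by
        rw [Finset.mul_sum]
        exact Finset.sum_le_sum fun i hi =>
          mul_le_mul_of_nonneg_right (hyc (r + 1) (by omega) hrm i hi) (hg r i)
      rw [Finset.sum_Ico_succ_top hr, mul_add]
      refine (add_le_add h1 h2).trans ?_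
      rw [← Finset.sum_add_distrib]
      refine Finset.sum_le_sum fun i hi => ?_
      rw [← mul_add]
      exact mul_le_mul_of_nonneg_left (hx r (Finset.mem_Ico.2 ⟨hr, hrm⟩) i hi) (hy0 _ hrm i)
  simpa [hym] using key m hlm le_rfl

/-- The step that enlarges the set `S` on which a supersolution is large. Either the value stays
large on `S` until the end, or at some time `r` it is large on `S` and at one more index. The
constant `c` is the one available for chains on fewer indices. -/
lemma IsSupersolutionOn.enlarge {ι : Type*} [DecidableEq ι] {p₀ γ β D : ℝ} {B : ℕ → Matrix ι ι ℝ}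
    {U S : Finset ι} {l m : ℕ} {x : ℕ → ι → ℝ} (hp : 0 < p₀) (hγ : 0 < γ) (hβ : 0 ≤ β)
    (h : IsReciprocalOn p₀ γ β D B U l m) (hlm : l ≤ m)
    (hx : IsSupersolutionOn B U l m x) (hS : S ⊆ U) {δ C₀ C c : ℝ} (hδ : 0 ≤ δ)
    (hC₀ : C₀ = (β + 1) / p₀) (hC : C = C₀ + U.card) (hc : 0 < c)
    (hxS : ∀ i ∈ S, δ ≤ x l i)
    (ih : ∀ l m : ℕ, l ≤ m → IsReciprocalOn p₀ γ (β + C) (D + (C + β) / p₀) B (U \ S) l m →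
      ∀ x, IsSupersolutionOn B (U \ S) l m x → ∀ j ∈ U \ S, c * x l j ≤ ∑ i ∈ U \ S, x m i) :
    (∀ i ∈ S, δ * Real.exp (-((D + C) / γ)) ≤ x m i) ∨
    ∃ r, l ≤ r ∧ r ≤ m ∧ (∀ i ∈ S, δ * Real.exp (-((D + C) / γ)) ≤ x r i) ∧
      ∃ i ∈ U \ S, c / U.card * (δ * Real.exp (-((D + C) / γ))) ≤ x r i := by
  have hC₀pos : 0 < C₀ := by rw [hC₀]; positivity
  by_cases hout : ∑ k ∈ Finset.Ico l m, blockSum (B k) S (U \ S) ≤ C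
  · exact Or.inl (hx.persist hγ h hS hδ hxS hout hlm le_rfl)
  · right
    have hex : ∃ r, l ≤ r ∧ C₀ < ∑ k ∈ Finset.Ico l r, blockSum (B k) S (U \ S) := by
      refine ⟨m, hlm, lt_of_le_of_lt ?_ (not_le.1 hout)⟩
      rw [hC]
      have : (0 : ℝ) ≤ U.card := by positivity
      linarith
    classical
    obtain ⟨hlr, hr⟩ := Nat.find_spec hex
    have hmin := fun q (hq : q < Nat.find hex) => Nat.find_min hex hq
    have hrm' : Nat.find hex ≤ m := Nat.find_min' hex (by
      refine ⟨hlm, lt_of_le_of_lt ?_ (not_le.1 hout)⟩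
      rw [hC]
      have : (0 : ℝ) ≤ U.card := by positivity
      linarith)
    generalize Nat.find hex = r at hlr hr hmin hrm'
    have hlr' : l < r := by
      rcases hlr.eq_or_lt with rfl | h'
      · simp at hr
        linarith
      · exact h'
    -- `r` is the first time at which the weight leaving `S` exceeds `C₀`, and one step adds at most
    -- the number of rows
    have hrC : ∑ k ∈ Finset.Ico l r, blockSum (B k) S (U \ S) ≤ C := by
      obtain ⟨q, rfl⟩ : ∃ q, r = q + 1 := ⟨r - 1, by omega⟩
      have hlq : l ≤ q := by omega
      have h1 := hmin q (by omega)
      push Not at h1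
      rw [Finset.sum_Ico_succ_top hlq, hC]
      exact add_le_add (h1 hlq)
        (h.blockSum_le_card hS (Finset.mem_Ico.2 ⟨hlq, by omega⟩))
    have hr' := h.mono_window le_rfl hrm'
    have hxr := hx.mono_window le_rfl hrm'
    set δ' := δ * Real.exp (-((D + C) / γ)) with hδ'
    have hδ'0 : 0 ≤ δ' := by positivity
    have hpers : ∀ k, l ≤ k → k ≤ r → ∀ i ∈ S, δ' ≤ x k i := fun k hk hkr =>
      hxr.persist hγ hr' hS hδ hxS hrC hk hkr
    refine ⟨r, hlr, hrm', hpers r hlr le_rfl, ?_⟩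
    have hV := hr'.sdiff hp hlr hS hrC
    have hin : 1 ≤ ∑ k ∈ Finset.Ico l r, blockSum (B k) (U \ S) S := by
      have h1 := hr'.reciprocal S hS l r le_rfl hlr le_rfl
      have h2 := mul_lt_mul_of_pos_left hr hp
      rw [hC₀, mul_div_cancel₀ _ hp.ne'] at h2
      linarith
    have hinj := sum_injection_le (B := B) (U := U \ S) (l := l) (m := r) (c := c)
      (x := x) (g := fun k i => δ' * ∑ j ∈ S, B k i j) h.nonneg hlr
      (fun k hlk hkr z hz j hj => ih k r hkr (hV.mono_window hlk le_rfl) z hz j hj) hx.nonneg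
      (fun k i => mul_nonneg hδ'0 (Finset.sum_nonneg fun j _ => h.nonneg k i j))
      (fun k hk i hi => by
        refine le_trans ?_ (hxr.le_succ k hk i (Finset.sdiff_subset hi))
        rw [← Finset.sum_sdiff hS, Finset.mul_sum]
        refine add_le_add le_rfl (Finset.sum_le_sum fun j hj => ?_)
        rw [mul_comm]
        have hk' := Finset.mem_Ico.1 hk
        exact mul_le_mul_of_nonneg_left (hpers k hk'.1 hk'.2.le j hj) (h.nonneg k i j))
    have hsum : c * δ' ≤ ∑ i ∈ U \ S, x r i := by
      refine le_trans ?_ hinj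
      simp_rw [← Finset.mul_sum]
      exact mul_le_mul_of_nonneg_left (le_mul_of_one_le_right hδ'0 hin) hc.le
    have hne : (U \ S).Nonempty := by
      by_contra hcon
      rw [Finset.not_nonempty_iff_eq_empty] at hcon
      simp [hcon, blockSum] at hin
      linarith
    by_contra hcon
    push Not at hcon
    have hUpos : (0 : ℝ) < U.card := by
      exact_mod_cast Finset.card_pos.2 (hne.mono Finset.sdiff_subset)
    have h3 : ∑ i ∈ U \ S, x r i < ∑ i ∈ U \ S, c / U.card * δ' :=
      Finset.sum_lt_sum_of_nonempty hne hcon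
    rw [Finset.sum_const, nsmul_eq_mul] at h3
    have h4 : ((U \ S).card : ℝ) ≤ U.card := by
      exact_mod_cast Finset.card_le_card Finset.sdiff_subset
    have h5 : ((U \ S).card : ℝ) * (c / U.card * δ') ≤ U.card * (c / U.card * δ') :=
      mul_le_mul_of_nonneg_right h4 (by positivity)
    have h6 : (U.card : ℝ) * (c / U.card * δ') = c * δ' := by field_simp
    linarith

/-- In an approximately reciprocal chain a supersolution never loses more than a constant factor of
the mass that it has at one index, uniformly in the length of the time window. -/
theorem exists_uniform_mass_bound {p₀ γ : ℝ} (hp : 0 < p₀) (hγ : 0 < γ) (d : ℕ) :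
    ∀ β D : ℝ, 0 ≤ β → 0 ≤ D → ∃ c : ℝ, 0 < c ∧
      ∀ {ι : Type} [DecidableEq ι] (B : ℕ → Matrix ι ι ℝ) (U : Finset ι), U.card ≤ d →
      ∀ l m : ℕ, l ≤ m → IsReciprocalOn p₀ γ β D B U l m →
      ∀ x, IsSupersolutionOn B U l m x → ∀ j ∈ U, c * x l j ≤ ∑ i ∈ U, x m i := by
  induction d with
  | zero =>
    intro β D _ _
    refine ⟨1, one_pos, fun B U hU => ?_⟩
    rw [Nat.le_zero, Finset.card_eq_zero] at hU
    subst hU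
    simp
  | succ d ihd =>
    intro β D hβ hD
    set C₀ := (β + 1) / p₀ with hC₀
    have hC₀0 : 0 ≤ C₀ := by positivity
    set a := Real.exp (-((D + (C₀ + (d + 1 : ℕ))) / γ)) with ha
    obtain ⟨c, hc, hcU⟩ := ihd (β + (C₀ + (d + 1 : ℕ))) (D + ((C₀ + (d + 1 : ℕ)) + β) / p₀)
      (by positivity) (by positivity)
    -- it suffices to start from an arbitrary set `S`, by induction on the size of its complement
    have key : ∀ q : ℕ, ∃ c' : ℝ, 0 < c' ∧
        ∀ {ι : Type} [DecidableEq ι] (B : ℕ → Matrix ι ι ℝ) (U : Finset ι), U.card = d + 1 →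
        ∀ l m : ℕ, l ≤ m → IsReciprocalOn p₀ γ β D B U l m →
        ∀ x, IsSupersolutionOn B U l m x → ∀ S ⊆ U, S.Nonempty → (U \ S).card ≤ q →
        ∀ δ, 0 ≤ δ → (∀ i ∈ S, δ ≤ x l i) → c' * δ ≤ ∑ i ∈ U, x m i := by
      intro q
      have hstep : ∀ {ι : Type} [DecidableEq ι] (B : ℕ → Matrix ι ι ℝ) (U : Finset ι),
          U.card = d + 1 → ∀ l m : ℕ, l ≤ m → IsReciprocalOn p₀ γ β D B U l m →
          ∀ x, IsSupersolutionOn B U l m x → ∀ S ⊆ U, S.Nonempty →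
          ∀ δ, 0 ≤ δ → (∀ i ∈ S, δ ≤ x l i) →
          a * δ ≤ ∑ i ∈ U, x m i ∨ ∃ r, l ≤ r ∧ r ≤ m ∧ (∀ i ∈ S, δ * a ≤ x r i) ∧
            ∃ i ∈ U \ S, c / (d + 1 : ℕ) * (δ * a) ≤ x r i := by
        intro ι _ B U hU l m hlm h x hx S hS hSne δ hδ hxS
        have hcard : (U \ S).card ≤ d := by
          have h1 := Finset.card_sdiff_add_card_eq_card hS
          have h2 := hSne.card_pos
          omega
        have := hx.enlarge hp hγ hβ h hlm hS hδ hC₀ (C := C₀ + (d + 1 : ℕ)) (by rw [hU]) hc hxS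
          (fun l m hlm' h' z hz => hcU B (U \ S) hcard l m hlm' h' z hz)
        rw [hU] at this
        refine this.imp (fun h1 => ?_) id
        obtain ⟨i, hi⟩ := hSne
        rw [mul_comm]
        exact (h1 i hi).trans (Finset.single_le_sum (fun j _ => hx.nonneg m j) (hS hi))
      induction q with
      | zero =>
        refine ⟨a, Real.exp_pos _, fun B U hU l m hlm h x hx S hS hSne hq δ hδ hxS => ?_⟩
        rcases hstep B U hU l m hlm h x hx S hS hSne δ hδ hxS with h1 | ⟨r, _, _, _, i, hi, _⟩
        · exact h1
        · rw [Nat.le_zero, Finset.card_eq_zero] at hq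
          simp [hq] at hi
      | succ q ihq =>
        obtain ⟨c', hc', hq⟩ := ihq
        have hb : 0 < min 1 (c / (d + 1 : ℕ)) := lt_min one_pos (by positivity)
        refine ⟨min a (c' * (min 1 (c / (d + 1 : ℕ)) * a)), lt_min (Real.exp_pos _)
          (by positivity), fun B U hU l m hlm h x hx S hS hSne hcard δ hδ hxS => ?_⟩
        rcases hstep B U hU l m hlm h x hx S hS hSne δ hδ hxS with
          h1 | ⟨r, hlr, hrm, hr, i, hi, hri⟩
        · exact (mul_le_mul_of_nonneg_right (min_le_left _ _) hδ).trans h1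
        · refine (mul_le_mul_of_nonneg_right (min_le_right _ _) hδ).trans ?_
          have hiU := Finset.mem_sdiff.1 hi
          have h2 := hq B U hU r m hrm (h.mono_window hlr le_rfl) x (hx.mono_window hlr le_rfl)
            (insert i S) (Finset.insert_subset hiU.1 hS) (Finset.insert_nonempty _ _) (by
              rw [Finset.sdiff_insert, Finset.card_erase_of_mem hi]
              omega) (min 1 (c / (d + 1 : ℕ)) * (δ * a)) (by positivity) (by
              intro k hk
              have h0 : 0 ≤ δ * a := by positivity
              rcases Finset.mem_insert.1 hk with rfl | hk
              · exact (mul_le_mul_of_nonneg_right (min_le_right _ _) h0).trans hri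
              · refine (mul_le_mul_of_nonneg_right (min_le_left _ _) h0).trans ?_
                simpa using hr k hk)
          refine le_trans (le_of_eq ?_) h2
          ring
    obtain ⟨c', hc', hkey⟩ := key d
    obtain ⟨c₁, hc₁, hU₁⟩ := ihd β D hβ hD
    refine ⟨min c' c₁, lt_min hc' hc₁, fun B U hU l m hlm h x hx j hj => ?_⟩
    rcases Nat.le_succ_iff.1 hU with hU | hU
    · exact (mul_le_mul_of_nonneg_right (min_le_right _ _) (hx.nonneg l j)).trans
        (hU₁ B U hU l m hlm h x hx j hj)
    · refine (mul_le_mul_of_nonneg_right (min_le_left _ _) (hx.nonneg l j)).trans ?_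
      refine hkey B U hU l m hlm h x hx {j} (by simpa using hj) (by simp) ?_ _ (hx.nonneg l j)
        (by simp)
      rw [Finset.card_sdiff_of_subset (by simpa using hj), hU]
      simp

/-! ### Primitives of integrable functions -/

lemma intervalIntegrable_fun_sum {ι : Type*} (s : Finset ι) {f : ι → ℝ → ℝ} {a b : ℝ}
    (h : ∀ i ∈ s, IntervalIntegrable (f i) MeasureTheory.volume a b) :
    IntervalIntegrable (fun t => ∑ i ∈ s, f i t) MeasureTheory.volume a b := by
  simpa only [Finset.sum_fn] using IntervalIntegrable.sum s h

lemma intervalIntegrable_mono {f : ℝ → ℝ} {a b c d : ℝ}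
    (h : IntervalIntegrable f MeasureTheory.volume a b) (hac : a ≤ c) (hcd : c ≤ d) (hdb : d ≤ b) :
    IntervalIntegrable f MeasureTheory.volume c d :=
  h.mono_set (by
    rw [Set.uIcc_of_le hcd, Set.uIcc_of_le (hac.trans (hcd.trans hdb))]
    exact Set.Icc_subset_Icc hac hdb)

/-- On `[a, b]` the function `x` is a primitive of the integrable function `f`. -/
structure IsPrimitiveOn (x f : ℝ → ℝ) (a b : ℝ) : Prop where
  integrable : IntervalIntegrable f MeasureTheory.volume a b
  eq : ∀ t ∈ Set.Icc a b, x t = x a + ∫ s in a..t, f s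

namespace IsPrimitiveOn

variable {x y f g : ℝ → ℝ} {a b : ℝ}

lemma mono (h : IsPrimitiveOn x f a b) {c d : ℝ} (hac : a ≤ c) (hcd : c ≤ d) (hdb : d ≤ b) :
    IsPrimitiveOn x f c d := by
  refine ⟨intervalIntegrable_mono h.integrable hac hcd hdb, fun t ht => ?_⟩
  rw [h.eq t ⟨hac.trans ht.1, ht.2.trans hdb⟩, h.eq c ⟨hac, hcd.trans hdb⟩, add_assoc,
    intervalIntegral.integral_add_adjacent_intervals]
  · exact intervalIntegrable_mono h.integrable le_rfl hac (hcd.trans hdb)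
  · exact intervalIntegrable_mono h.integrable hac ht.1 (ht.2.trans hdb)

lemma const (c a b : ℝ) : IsPrimitiveOn (fun _ => c) (fun _ => 0) a b :=
  ⟨by simp, by simp⟩

lemma integral (hf : IntervalIntegrable f MeasureTheory.volume a b) :
    IsPrimitiveOn (fun t => ∫ s in a..t, f s) f a b :=
  ⟨hf, by simp⟩

lemma congr (h : IsPrimitiveOn x f a b) (hab : a ≤ b) (hx : ∀ t ∈ Set.Icc a b, y t = x t)
    (hf : ∀ t ∈ Set.Icc a b, g t = f t) : IsPrimitiveOn y g a b := by
  have hfg : ∀ t ∈ Set.Icc a b, Set.EqOn f g (Set.uIoc a t) := fun t ht s hs => by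
    rw [Set.uIoc_of_le ht.1] at hs
    exact (hf s ⟨hs.1.le, hs.2.trans ht.2⟩).symm
  refine ⟨h.integrable.congr (hfg b ⟨hab, le_rfl⟩), fun t ht => ?_⟩
  rw [hx t ht, hx a ⟨le_rfl, hab⟩, h.eq t ht]
  congr 1
  exact intervalIntegral.integral_congr_ae (Filter.Eventually.of_forall (hfg t ht))

lemma add (hx : IsPrimitiveOn x f a b) (hy : IsPrimitiveOn y g a b) :
    IsPrimitiveOn (fun t => x t + y t) (fun t => f t + g t) a b := by
  refine ⟨hx.integrable.add hy.integrable, fun t ht => ?_⟩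
  rw [intervalIntegral.integral_add (intervalIntegrable_mono hx.integrable le_rfl ht.1 ht.2)
    (intervalIntegrable_mono hy.integrable le_rfl ht.1 ht.2), hx.eq t ht, hy.eq t ht]
  ring

lemma const_mul (hx : IsPrimitiveOn x f a b) (c : ℝ) :
    IsPrimitiveOn (fun t => c * x t) (fun t => c * f t) a b := by
  refine ⟨hx.integrable.const_mul c, fun t ht => ?_⟩
  rw [intervalIntegral.integral_const_mul, hx.eq t ht]
  ring

lemma sub (hx : IsPrimitiveOn x f a b) (hy : IsPrimitiveOn y g a b) :
    IsPrimitiveOn (fun t => x t - y t) (fun t => f t - g t) a b := by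
  simpa [sub_eq_add_neg] using hx.add (hy.const_mul (-1))

lemma sum {ι : Type*} (s : Finset ι) {x f : ι → ℝ → ℝ}
    (h : ∀ i ∈ s, IsPrimitiveOn (x i) (f i) a b) :
    IsPrimitiveOn (fun t => ∑ i ∈ s, x i t) (fun t => ∑ i ∈ s, f i t) a b := by
  classical
  induction s using Finset.induction_on with
  | empty => simpa using const 0 a b
  | insert i s hi ih =>
    simp only [Finset.sum_insert hi]
    exact (h i (Finset.mem_insert_self i s)).add
      (ih fun j hj => h j (Finset.mem_insert_of_mem hj))

/-- The values of `x` off `[a, b]` are arbitrary, so absolute continuity and derivatives are stated for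
the integral that represents `x` on `[a, b]`. -/
lemma absolutelyContinuous_integral (hx : IsPrimitiveOn x f a b) :
    AbsolutelyContinuousOnInterval (fun t => x a + ∫ s in a..t, f s) a b :=
  (LipschitzOnWith.of_dist_le_mul (K := 0) (by simp)).absolutelyContinuousOnInterval.fun_add
    (hx.integrable.absolutelyContinuousOnInterval_intervalIntegral Set.left_mem_uIcc)

lemma of_absolutelyContinuous (hab : a ≤ b) (hx : AbsolutelyContinuousOnInterval x a b)
    (hf : ∀ᵐ t, t ∈ Set.uIcc a b → HasDerivAt x (f t) t) : IsPrimitiveOn x f a b := by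
  have hae : ∀ᵐ t, t ∈ Set.uIcc a b → deriv x t = f t := by
    filter_upwards [hf] with t ht h
    exact (ht h).deriv
  refine ⟨hx.intervalIntegrable_deriv.congr_ae ?_, fun t ht => ?_⟩
  · rw [Filter.EventuallyEq, MeasureTheory.ae_restrict_iff' measurableSet_uIoc]
    filter_upwards [hae] with t ht h
    exact ht (Set.uIoc_subset_uIcc h)
  · have hsub : Set.uIcc a t ⊆ Set.uIcc a b := by
      rw [Set.uIcc_of_le ht.1, Set.uIcc_of_le hab]
      exact Set.Icc_subset_Icc le_rfl ht.2
    have h1 := (hx.mono hsub).integral_deriv_eq_sub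
    have h2 : ∫ s in a..t, deriv x s = ∫ s in a..t, f s := by
      apply intervalIntegral.integral_congr_ae
      filter_upwards [hae] with s hs h
      exact hs (hsub (Set.uIoc_subset_uIcc h))
    linarith

lemma absolutelyContinuous_integral_hasDerivAt (hx : IsPrimitiveOn x f a b) :
    ∀ᵐ t, t ∈ Set.uIcc a b → HasDerivAt (fun t => x a + ∫ s in a..t, f s) (f t) t := by
  filter_upwards [hx.integrable.ae_hasDerivAt_integral] with t ht h
  exact (ht h a Set.left_mem_uIcc).const_add _

lemma mul (hab : a ≤ b) (hx : IsPrimitiveOn x f a b) (hy : IsPrimitiveOn y g a b) :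
    IsPrimitiveOn (fun t => x t * y t) (fun t => f t * y t + x t * g t) a b := by
  refine (of_absolutelyContinuous hab
    (hx.absolutelyContinuous_integral.fun_mul hy.absolutelyContinuous_integral) (f := fun t =>
      f t * (y a + ∫ s in a..t, g s) + (x a + ∫ s in a..t, f s) * g t) ?_).congr hab ?_ ?_
  · filter_upwards [hx.absolutelyContinuous_integral_hasDerivAt,
      hy.absolutelyContinuous_integral_hasDerivAt] with t h1 h2 h
    exact (h1 h).mul (h2 h)
  · intro t ht
    simp only [hx.eq t ht, hy.eq t ht]
  · intro t ht
    simp only [hx.eq t ht, hy.eq t ht]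

lemma continuousOn (hab : a ≤ b) (hx : IsPrimitiveOn x f a b) : ContinuousOn x (Set.Icc a b) := by
  have := hx.absolutelyContinuous_integral.continuousOn
  rw [Set.uIcc_of_le hab] at this
  exact this.congr fun t ht => hx.eq t ht

/-- The chain rule for `exp`: it is Lipschitz on the bounded range of `x`, so `exp ∘ x` is absolutely
continuous. -/
lemma exp (hab : a ≤ b) (hx : IsPrimitiveOn x f a b) :
    IsPrimitiveOn (fun t => Real.exp (x t)) (fun t => f t * Real.exp (x t)) a b := by
  set X : ℝ → ℝ := fun t => x a + ∫ s in a..t, f s with hX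
  have hac := hx.absolutelyContinuous_integral
  have hac' : AbsolutelyContinuousOnInterval (fun t => Real.exp (X t)) a b := by
    obtain ⟨C, hC⟩ := hac.exists_bound
    have hlip : ∀ u v : ℝ, u ≤ C → v ≤ C →
        dist (Real.exp u) (Real.exp v) ≤ Real.exp C * dist u v := by
      intro u v hu hv
      wlog huv : v ≤ u generalizing u v
      · rw [dist_comm, dist_comm u]
        exact this v u hv hu (not_le.1 huv).le
      rw [Real.dist_eq, Real.dist_eq, abs_of_nonneg (sub_nonneg.2 (Real.exp_le_exp.2 huv)),
        abs_of_nonneg (sub_nonneg.2 huv)]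
      have h1 := Real.add_one_le_exp (v - u)
      have h2 : Real.exp u * Real.exp (v - u) = Real.exp v := by rw [← Real.exp_add]; ring_nf
      have h3 := mul_le_mul_of_nonneg_left h1 (Real.exp_pos u).le
      have h4 := mul_le_mul_of_nonneg_right (Real.exp_le_exp.2 hu) (sub_nonneg.2 huv)
      linarith
    unfold AbsolutelyContinuousOnInterval at hac ⊢
    have hlim := hac.const_mul (Real.exp C)
    rw [mul_zero] at hlim
    refine squeeze_zero' (Filter.Eventually.of_forall fun _ =>
      Finset.sum_nonneg fun i hi => dist_nonneg) ?_ hlim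
    rw [Filter.eventually_inf_principal]
    filter_upwards with E hE
    rw [Finset.mul_sum]
    refine Finset.sum_le_sum fun i hi => hlip _ _ ?_ ?_
    · exact (le_abs_self _).trans (hC _ (hE.1 i hi).1)
    · exact (le_abs_self _).trans (hC _ (hE.1 i hi).2)
  refine (of_absolutelyContinuous hab hac' (f := fun t => f t * Real.exp (X t)) ?_).congr hab ?_ ?_
  · filter_upwards [hx.absolutelyContinuous_integral_hasDerivAt] with t h1 h
    simpa [mul_comm] using (h1 h).exp
  · intro t ht
    simp only [hX, hx.eq t ht]
  · intro t ht
    simp only [hX, hx.eq t ht]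

lemma le_of_nonneg (hx : IsPrimitiveOn x f a b) (hf : ∀ t ∈ Set.Icc a b, 0 ≤ f t) {t : ℝ}
    (ht : t ∈ Set.Icc a b) : x a ≤ x t := by
  rw [hx.eq t ht]
  exact le_add_of_nonneg_right (intervalIntegral.integral_nonneg ht.1
    fun s hs => hf s ⟨hs.1, hs.2.trans ht.2⟩)

end IsPrimitiveOn

/-! ### Linear systems with integrable coefficients -/

/-- The sum of the absolute values of all entries of `B`. -/
def entrySum {ι : Type*} [Fintype ι] (B : Matrix ι ι ℝ) : ℝ :=
  ∑ i, ∑ j, |B i j|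

lemma sum_abs_row_le_entrySum {ι : Type*} [Fintype ι] (B : Matrix ι ι ℝ) (i : ι) :
    ∑ j, |B i j| ≤ entrySum B :=
  Finset.single_le_sum (f := fun i => ∑ j, |B i j|)
    (fun _ _ => Finset.sum_nonneg fun _ _ => abs_nonneg _) (Finset.mem_univ i)

lemma entrySum_nonneg {ι : Type*} [Fintype ι] (B : Matrix ι ι ℝ) : 0 ≤ entrySum B :=
  Finset.sum_nonneg fun _ _ => Finset.sum_nonneg fun _ _ => abs_nonneg _

lemma intervalIntegrable_entrySum {ι : Type*} [Fintype ι] {A : ℝ → Matrix ι ι ℝ} {a b : ℝ}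
    (hA : ∀ i j, IntervalIntegrable (fun s => A s i j) MeasureTheory.volume a b) :
    IntervalIntegrable (fun s => entrySum (A s)) MeasureTheory.volume a b :=
  intervalIntegrable_fun_sum _ fun i _ => intervalIntegrable_fun_sum _ fun j _ => (hA i j).abs

/-- Comparison principle for a linear system whose matrix has nonnegative off-diagonal entries: a
supersolution that starts nonnegative stays nonnegative. -/
theorem nonneg_of_supersolution {ι : Type*} [Fintype ι] {A : ℝ → Matrix ι ι ℝ} {a b : ℝ}
    (hA : ∀ i j, IntervalIntegrable (fun s => A s i j) MeasureTheory.volume a b)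
    (hM : ∀ s ∈ Set.Icc a b, ∀ i j, i ≠ j → 0 ≤ A s i j) {x f : ι → ℝ → ℝ}
    (hx : ∀ i, IsPrimitiveOn (x i) (f i) a b)
    (hf : ∀ s ∈ Set.Icc a b, ∀ i, ∑ j, A s i j * x j s ≤ f i s) (h0 : ∀ i, 0 ≤ x i a)
    {t : ℝ} (ht : t ∈ Set.Icc a b) (i : ι) : 0 ≤ x i t := by
  classical
  have hab : a ≤ b := ht.1.trans ht.2
  set d : ℝ → ℝ := fun s => entrySum (A s) with hd
  set D : ℝ → ℝ := fun t => ∫ s in a..t, d s with hD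
  have hDp : IsPrimitiveOn D d a b := IsPrimitiveOn.integral (intervalIntegrable_entrySum hA)
  have hDa : D a = 0 := by simp [hD]
  have hz := fun i => (hDp.exp hab).mul hab (hx i)
  have hw := (hDp.const_mul 4).exp hab
  -- `exp D * x` relative to the weight `exp (4 D)` attains its minimum `μ`; a negative `μ` would
  -- reproduce itself with the factor `1 / 2`
  set φ : ι → ℝ → ℝ := fun i t => Real.exp (D t) * x i t / Real.exp (4 * D t) with hφ
  have hφc : ∀ i, ContinuousOn (φ i) (Set.Icc a b) := fun i =>
    ((hz i).continuousOn hab).div (hw.continuousOn hab) fun t _ => (Real.exp_pos _).ne'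
  choose τ hτ hτmin using fun i =>
    isCompact_Icc.exists_isMinOn ⟨a, Set.left_mem_Icc.2 hab⟩ (hφc i)
  obtain ⟨k, -, hk⟩ := Finset.exists_min_image Finset.univ (fun i => φ i (τ i)) ⟨i, Finset.mem_univ i⟩
  set μ := φ k (τ k) with hμ
  have hall : ∀ s ∈ Set.Icc a b, ∀ j, μ ≤ φ j s := fun s hs j =>
    (hk j (Finset.mem_univ j)).trans (hτmin j hs)
  rcases le_or_gt 0 μ with h | hneg
  · have h1 := h.trans (hall t ht i)
    have h2 : x i t = φ i t * (Real.exp (4 * D t) / Real.exp (D t)) := by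
      simp only [hφ]
      field_simp
    rw [h2]
    positivity
  · exfalso
    have hge : ∀ s ∈ Set.Icc a b, ∀ j, μ * Real.exp (4 * D s) ≤ Real.exp (D s) * x j s :=
      fun s hs j => (le_div_iff₀ (Real.exp_pos _)).1 (hall s hs j)
    have hq := (hz k).sub (hw.const_mul (μ / 2))
    have hmono := hq.le_of_nonneg (t := τ k) (fun s hs => by
      have hcoef : ∀ j, 0 ≤ A s k j + if k = j then d s else 0 := by
        intro j
        split_ifs with h
        · subst h
          have h1 := (Finset.single_le_sum (f := fun j => |A s k j|)
            (fun j _ => abs_nonneg _) (Finset.mem_univ k)).trans (sum_abs_row_le_entrySum (A s) k)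
          have h2 := neg_abs_le (A s k k)
          simp only [hd]
          linarith
        · simpa using hM s hs k j h
      have h1 : 0 ≤ ∑ j, (A s k j + if k = j then d s else 0) *
          (Real.exp (D s) * x j s - μ * Real.exp (4 * D s)) :=
        Finset.sum_nonneg fun j _ => mul_nonneg (hcoef j) (sub_nonneg.2 (hge s hs j))
      have h2 : ∑ j, (A s k j + if k = j then d s else 0) *
          (Real.exp (D s) * x j s - μ * Real.exp (4 * D s)) =
          Real.exp (D s) * ∑ j, A s k j * x j s + d s * (Real.exp (D s) * x k s) -
            μ * Real.exp (4 * D s) * (∑ j, A s k j + d s) := by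
        simp only [add_mul, mul_sub, Finset.sum_add_distrib, Finset.sum_sub_distrib, ite_mul,
          zero_mul, Finset.sum_ite_eq, Finset.mem_univ, if_true, Finset.mul_sum]
        rw [mul_add, Finset.mul_sum]
        have e1 : ∑ j, A s k j * (Real.exp (D s) * x j s) =
            ∑ j, Real.exp (D s) * (A s k j * x j s) :=
          Finset.sum_congr rfl fun j _ => by ring
        have e2 : ∑ j, A s k j * (μ * Real.exp (4 * D s)) =
            ∑ j, μ * Real.exp (4 * D s) * A s k j :=
          Finset.sum_congr rfl fun j _ => by ring
        rw [e1, e2]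
        ring
      rw [h2] at h1
      have h3 : ∑ j, A s k j ≤ d s :=
        (Finset.sum_le_sum fun j _ => le_abs_self _).trans (sum_abs_row_le_entrySum (A s) k)
      have h4 : 0 ≤ -μ * Real.exp (4 * D s) := by
        have := Real.exp_pos (4 * D s)
        nlinarith
      have h5 := mul_le_mul_of_nonneg_left h3 h4
      have h6 := mul_le_mul_of_nonneg_left (hf s hs k) (Real.exp_pos (D s)).le
      linarith) (hτ k)
    have hend : μ * Real.exp (4 * D (τ k)) = Real.exp (D (τ k)) * x k (τ k) :=
      div_mul_cancel₀ _ (Real.exp_pos _).ne'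
    simp only [hDa, mul_zero, Real.exp_zero, one_mul, mul_one] at hmono
    have h1 := h0 k
    have h2 : μ * Real.exp (4 * D (τ k)) < 0 := mul_neg_of_neg_of_pos hneg (Real.exp_pos _)
    linarith

/-- A scalar supersolution of `ẋ = -d x + g` is bounded below by a multiple of its initial value plus
the integral of the source term. -/
lemma IsPrimitiveOn.exp_mul_le {x f d g : ℝ → ℝ} {a b : ℝ} (hab : a ≤ b)
    (hx : IsPrimitiveOn x f a b) (hd : IntervalIntegrable d MeasureTheory.volume a b)
    (hg : IntervalIntegrable g MeasureTheory.volume a b) (hd0 : ∀ s ∈ Set.Icc a b, 0 ≤ d s)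
    (hg0 : ∀ s ∈ Set.Icc a b, 0 ≤ g s)
    (hf : ∀ s ∈ Set.Icc a b, -(d s * x s) + g s ≤ f s) :
    Real.exp (-∫ s in a..b, d s) * (x a + ∫ s in a..b, g s) ≤ x b := by
  set D : ℝ → ℝ := fun t => ∫ s in a..t, d s with hD
  have hDp : IsPrimitiveOn D d a b := IsPrimitiveOn.integral hd
  have hb : b ∈ Set.Icc a b := Set.right_mem_Icc.2 hab
  have hDa : D a = 0 := by simp [hD]
  have h1 := ((hDp.exp hab).mul hab hx).sub (IsPrimitiveOn.integral hg)
  have h2 := h1.le_of_nonneg (fun s hs => by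
    have e1 : (1 : ℝ) ≤ Real.exp (D s) := by
      rw [← Real.exp_zero]
      exact Real.exp_le_exp.2 (intervalIntegral.integral_nonneg hs.1
        fun u hu => hd0 u ⟨hu.1, hu.2.trans hs.2⟩)
    have e2 := mul_le_mul_of_nonneg_left (hf s hs) (Real.exp_pos (D s)).le
    have e3 := mul_le_mul_of_nonneg_right e1 (hg0 s hs)
    linarith) hb
  simp only [hDa, Real.exp_zero, one_mul, intervalIntegral.integral_same, sub_zero] at h2
  have h3 : x a + ∫ s in a..b, g s ≤ Real.exp (D b) * x b := by linarith
  calc Real.exp (-D b) * (x a + ∫ s in a..b, g s)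
      ≤ Real.exp (-D b) * (Real.exp (D b) * x b) :=
        mul_le_mul_of_nonneg_left h3 (Real.exp_pos _).le
    _ = x b := by rw [← mul_assoc, ← Real.exp_add]; simp

/-- Global solvability of the linear system `ẋ = A x` with locally integrable coefficients, in
integrated form. In the norm weighted by `exp (-2 ∫ |A|)` the Picard operator contracts with factor
`1 / 2`. -/
theorem exists_linear_solution {ι : Type*} [Fintype ι] {A : ℝ → Matrix ι ι ℝ}
    (hA : ∀ i j a b, IntervalIntegrable (fun s => A s i j) MeasureTheory.volume a b) (τ : ℝ)
    (v : ι → ℝ) : ∃ x : ι → ℝ → ℝ, (∀ i, x i τ = v i) ∧ ∀ b, τ ≤ b → ∀ i,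
      IsPrimitiveOn (x i) (fun s => ∑ j, A s i j * x j s) τ b := by
  set d : ℝ → ℝ := fun s => entrySum (A s) with hd
  have hdi : ∀ a b, IntervalIntegrable d MeasureTheory.volume a b := fun a b =>
    intervalIntegrable_entrySum fun i j => hA i j a b
  set D : ℝ → ℝ := fun t => ∫ s in τ..t, d s with hD
  have hDc : Continuous D := intervalIntegral.continuous_primitive hdi τ
  have hwc : Continuous fun s => Real.exp (2 * D s) := Real.continuous_exp.comp (hDc.const_mul 2)
  have hint : ∀ (z : ℝ → ι → ℝ), Continuous z → ∀ i a b, IntervalIntegrable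
      (fun s => ∑ j, A s i j * (Real.exp (2 * D s) * z s j)) MeasureTheory.volume a b := by
    intro z hz i a b
    exact intervalIntegrable_fun_sum _ fun j _ =>
      (hA i j a b).mul_continuousOn (hwc.mul ((continuous_apply j).comp hz)).continuousOn
  have hbound : ∀ (z : ℝ → ι → ℝ), Continuous z → ∀ C, (∀ s j, |z s j| ≤ C) → ∀ i t, τ ≤ t →
      Real.exp (-(2 * D t)) *
        |∫ s in τ..t, ∑ j, A s i j * (Real.exp (2 * D s) * z s j)| ≤ C / 2 := by
    intro z hz C hC i t ht
    have hC0 : 0 ≤ C := (abs_nonneg _).trans (hC τ i)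
    have hp := (((IsPrimitiveOn.integral (hdi τ t)).const_mul 2).exp ht).const_mul (C / 2)
    have h1 := hp.eq t ⟨ht, le_rfl⟩
    have h2 : |∫ s in τ..t, ∑ j, A s i j * (Real.exp (2 * D s) * z s j)| ≤
        ∫ s in τ..t, C / 2 * (2 * d s * Real.exp (2 * D s)) := by
      rw [← Real.norm_eq_abs]
      refine intervalIntegral.norm_integral_le_of_norm_le ht
        (Filter.Eventually.of_forall fun s _ => ?_) hp.integrable
      rw [Real.norm_eq_abs]
      calc |∑ j, A s i j * (Real.exp (2 * D s) * z s j)|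
          ≤ ∑ j, |A s i j| * (Real.exp (2 * D s) * C) := by
            refine (Finset.abs_sum_le_sum_abs _ _).trans (Finset.sum_le_sum fun j _ => ?_)
            rw [abs_mul, abs_mul, abs_of_pos (Real.exp_pos _)]
            exact mul_le_mul_of_nonneg_left
              (mul_le_mul_of_nonneg_left (hC s j) (Real.exp_pos _).le) (abs_nonneg _)
        _ ≤ d s * (Real.exp (2 * D s) * C) := by
            rw [← Finset.sum_mul]
            exact mul_le_mul_of_nonneg_right (sum_abs_row_le_entrySum _ i) (by positivity)
        _ = C / 2 * (2 * d s * Real.exp (2 * D s)) := by ring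
    simp only [intervalIntegral.integral_same, mul_zero, Real.exp_zero, mul_one] at h1
    have h3 : ∫ s in τ..t, C / 2 * (2 * d s * Real.exp (2 * D s)) ≤
        C / 2 * Real.exp (2 * D t) := by
      simp only [hD]
      linarith
    calc Real.exp (-(2 * D t)) * |∫ s in τ..t, ∑ j, A s i j * (Real.exp (2 * D s) * z s j)|
        ≤ Real.exp (-(2 * D t)) * (C / 2 * Real.exp (2 * D t)) :=
          mul_le_mul_of_nonneg_left (h2.trans h3) (Real.exp_pos _).le
      _ = C / 2 := by
          rw [mul_left_comm, ← Real.exp_add]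
          simp
  have hD0 : ∀ t, τ ≤ t → 0 ≤ D t := fun t ht =>
    intervalIntegral.integral_nonneg ht fun s _ => entrySum_nonneg _
  have hcont : ∀ z : BoundedContinuousFunction ℝ (ι → ℝ), Continuous fun t i =>
      Real.exp (-(2 * D (max τ t))) *
        (v i + ∫ s in τ..max τ t, ∑ j, A s i j * (Real.exp (2 * D s) * z s j)) := by
    intro z
    refine continuous_pi fun i => ?_
    have h1 : Continuous fun t => max τ t := continuous_const.max continuous_id
    refine (Real.continuous_exp.comp ((hDc.comp h1).const_mul 2).neg).mul
      (continuous_const.add ?_)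
    exact (intervalIntegral.continuous_primitive (fun a b => hint z z.continuous i a b) τ).comp h1
  have hzb : ∀ (z : BoundedContinuousFunction ℝ (ι → ℝ)) s j, |z s j| ≤ ‖z‖ := fun z s j =>
    (norm_le_pi_norm (z s) j).trans (z.norm_coe_le_norm s)
  set T : BoundedContinuousFunction ℝ (ι → ℝ) → BoundedContinuousFunction ℝ (ι → ℝ) := fun z =>
    BoundedContinuousFunction.ofNormedAddCommGroup _ (hcont z) (‖v‖ + ‖z‖ / 2) (by
      intro t
      refine (pi_norm_le_iff_of_nonneg (by positivity)).2 fun i => ?_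
      have ht : τ ≤ max τ t := le_max_left _ _
      rw [mul_add, Real.norm_eq_abs]
      refine (abs_add_le _ _).trans (add_le_add ?_ ?_)
      · rw [abs_mul, abs_of_pos (Real.exp_pos _)]
        refine (mul_le_of_le_one_left (abs_nonneg _) ?_).trans (norm_le_pi_norm v i)
        exact Real.exp_le_one_iff.2 (by linarith [hD0 _ ht])
      · rw [abs_mul, abs_of_pos (Real.exp_pos _)]
        exact hbound z z.continuous _ (hzb z) i _ ht) with hT
  have hTapp : ∀ z t i, T z t i = Real.exp (-(2 * D (max τ t))) *
        (v i + ∫ s in τ..max τ t, ∑ j, A s i j * (Real.exp (2 * D s) * z s j)) :=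
    fun z t i => rfl
  have hcontr : ContractingWith (1 / 2) T := by
    refine ⟨by
      rw [← NNReal.coe_lt_coe]
      norm_num, LipschitzWith.of_dist_le_mul fun z w => ?_⟩
    rw [BoundedContinuousFunction.dist_le (by positivity)]
    intro t
    refine (dist_pi_le_iff (by positivity)).2 fun i => ?_
    rw [hTapp, hTapp, Real.dist_eq, ← mul_sub, add_sub_add_left_eq_sub,
      ← intervalIntegral.integral_sub (hint z z.continuous i _ _) (hint w w.continuous i _ _),
      abs_mul, abs_of_pos (Real.exp_pos _)]
    have h1 := hbound (fun s => z s - w s) (z.continuous.sub w.continuous) (dist z w)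
      (fun s j => by
        rw [dist_eq_norm]
        exact hzb (z - w) s j) i (max τ t) (le_max_left _ _)
    have h2 : ∀ s, ∑ j, A s i j * (Real.exp (2 * D s) * z s j) -
        ∑ j, A s i j * (Real.exp (2 * D s) * w s j) =
        ∑ j, A s i j * (Real.exp (2 * D s) * (z s - w s) j) := by
      intro s
      rw [← Finset.sum_sub_distrib]
      exact Finset.sum_congr rfl fun j _ => by simp only [Pi.sub_apply]; ring
    simp_rw [h2]
    refine h1.trans (le_of_eq ?_)
    push_cast
    ring
  set z := hcontr.fixedPoint T with hz
  have hfix : T z = z := hcontr.fixedPoint_isFixedPt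
  have hx : ∀ t, τ ≤ t → ∀ i, Real.exp (2 * D t) * z t i =
      v i + ∫ s in τ..t, ∑ j, A s i j * (Real.exp (2 * D s) * z s j) := by
    intro t ht i
    have h1 := hTapp z t i
    rw [hfix, max_eq_right ht] at h1
    rw [h1, ← mul_assoc, ← Real.exp_add]
    simp
  have hxτ : ∀ i, Real.exp (2 * D τ) * z τ i = v i := fun i => by simpa using hx τ le_rfl i
  exact ⟨fun i t => Real.exp (2 * D t) * z t i, hxτ, fun b hb i =>
    ⟨hint z z.continuous i τ b, fun t ht => by simp only [hxτ]; exact hx t ht.1 i⟩⟩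

/-! ### Transition matrices of generator families -/

/-- `A s` is, at every real time `s`, the generator of a continuous-time Markov chain (nonnegative
off-diagonal entries, zero row sums), with entries integrable on all bounded intervals. -/
structure IsGeneratorFamily {n : ℕ} (A : ℝ → Matrix (Fin n) (Fin n) ℝ) : Prop where
  offDiag_nonneg : ∀ s i j, i ≠ j → 0 ≤ A s i j
  row_sum : ∀ s i, ∑ j, A s i j = 0
  integrable : ∀ i j a b, IntervalIntegrable (fun s => A s i j) MeasureTheory.volume a b

section

variable {n : ℕ} {A : ℝ → Matrix (Fin n) (Fin n) ℝ} {Φ : ℝ → ℝ → Matrix (Fin n) (Fin n) ℝ}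
  {τ a b : ℝ}

lemma IsGeneratorFamily.nonneg_of_solution (hA : IsGeneratorFamily A) {x : Fin n → ℝ → ℝ}
    (hx : ∀ i, IsPrimitiveOn (x i) (fun s => ∑ j, A s i j * x j s) a b) (h0 : ∀ i, 0 ≤ x i a)
    {t : ℝ} (ht : t ∈ Set.Icc a b) (i : Fin n) : 0 ≤ x i t :=
  nonneg_of_supersolution (fun i j => hA.integrable i j a b) (fun s _ => hA.offDiag_nonneg s) hx
    (fun _ _ _ => le_rfl) h0 ht i

lemma IsGeneratorFamily.eq_zero_of_solution (hA : IsGeneratorFamily A) {x : Fin n → ℝ → ℝ}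
    (hx : ∀ i, IsPrimitiveOn (x i) (fun s => ∑ j, A s i j * x j s) a b) (h0 : ∀ i, x i a = 0)
    {t : ℝ} (ht : t ∈ Set.Icc a b) (i : Fin n) : x i t = 0 := by
  refine le_antisymm ?_ (hA.nonneg_of_solution hx (fun i => (h0 i).ge) ht i)
  have h := hA.nonneg_of_solution (x := fun i s => -1 * x i s) (fun i => by
    convert (hx i).const_mul (-1) using 2 with s
    rw [Finset.mul_sum]
    exact Finset.sum_congr rfl fun j _ => by ring) (fun i => by simp [h0 i]) ht i
  linarith

lemma IsGeneratorFamily.exists_stateTransitionMatrix (hA : IsGeneratorFamily A) :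
    ∃ Φ : ℝ → ℝ → Matrix (Fin n) (Fin n) ℝ, IsStateTransitionMatrix A Φ := by
  choose x hx0 hx using fun (τ : ℝ) (j : Fin n) =>
    exists_linear_solution hA.integrable τ (Pi.single j (1 : ℝ))
  refine ⟨fun t τ => Matrix.of fun i j => x τ j i t, fun t τ _ hτt i j => ?_⟩
  have h := hx τ j t hτt i
  have h1 : ∀ s, (A s * Matrix.of fun i j => x τ j i s) i j = ∑ k, A s i k * x τ j k s := fun s => by
    simp [Matrix.mul_apply]
  simp only [h1]
  refine ⟨h.integrable, ?_⟩
  rw [Matrix.of_apply, h.eq t ⟨hτt, le_rfl⟩, hx0, Matrix.one_apply, Pi.single_apply]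

namespace IsStateTransitionMatrix

lemma self_eq_one (hΦ : IsStateTransitionMatrix A Φ) (hτ : 0 ≤ τ) : Φ τ τ = 1 := by
  ext i j
  simpa using (hΦ τ τ hτ le_rfl i j).2

lemma isPrimitiveOn (hΦ : IsStateTransitionMatrix A Φ) (hτ : 0 ≤ τ) (hb : τ ≤ b) (i j : Fin n) :
    IsPrimitiveOn (fun s => Φ s τ i j) (fun s => ∑ k, A s i k * Φ s τ k j) τ b := by
  have h : ∀ s, ∑ k, A s i k * Φ s τ k j = (A s * Φ s τ) i j := fun s => (Matrix.mul_apply).symm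
  simp only [h]
  refine ⟨(hΦ b τ hτ hb i j).1, fun t ht => ?_⟩
  rw [hΦ.self_eq_one hτ]
  exact (hΦ t τ hτ ht.1 i j).2

lemma nonneg (hA : IsGeneratorFamily A) (hΦ : IsStateTransitionMatrix A Φ) (hτ : 0 ≤ τ)
    (hb : τ ≤ b) (i j : Fin n) : 0 ≤ Φ b τ i j :=
  hA.nonneg_of_solution (x := fun i s => Φ s τ i j) (fun i => hΦ.isPrimitiveOn hτ hb i j)
    (fun i => by
      simp only [hΦ.self_eq_one hτ, Matrix.one_apply]
      split_ifs <;> norm_num) ⟨hb, le_rfl⟩ i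

lemma row_sum (hA : IsGeneratorFamily A) (hΦ : IsStateTransitionMatrix A Φ) (hτ : 0 ≤ τ)
    (hb : τ ≤ b) (i : Fin n) : ∑ j, Φ b τ i j = 1 := by
  have h := hA.eq_zero_of_solution (x := fun i s => ∑ j, Φ s τ i j - 1) (a := τ) (b := b)
    (fun i => by
      convert (IsPrimitiveOn.sum Finset.univ fun j _ => hΦ.isPrimitiveOn hτ hb i j).sub
        (IsPrimitiveOn.const 1 τ b) using 2 with s
      simp only [mul_sub, Finset.sum_sub_distrib, mul_one, hA.row_sum, sub_zero, Finset.mul_sum]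
      exact Finset.sum_comm) (fun i => by simp [hΦ.self_eq_one hτ, Matrix.one_apply])
    ⟨hb, le_rfl⟩ i
  linarith

/-- The semigroup property of transition matrices. -/
lemma mul_eq (hA : IsGeneratorFamily A) (hΦ : IsStateTransitionMatrix A Φ) (hτ : 0 ≤ τ)
    (ha : τ ≤ a) (hb : a ≤ b) : Φ b a * Φ a τ = Φ b τ := by
  ext i j
  have h := hA.eq_zero_of_solution
    (x := fun i s => Φ s τ i j - ∑ k, Φ a τ k j * Φ s a i k) (a := a) (b := b)
    (fun i => by
      convert ((hΦ.isPrimitiveOn hτ (ha.trans hb) i j).mono ha hb le_rfl).sub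
        (IsPrimitiveOn.sum Finset.univ fun k _ =>
          (hΦ.isPrimitiveOn (hτ.trans ha) hb i k).const_mul (Φ a τ k j)) using 2 with s
      simp only [mul_sub, Finset.sum_sub_distrib, Finset.mul_sum]
      congr 1
      rw [Finset.sum_comm]
      exact Finset.sum_congr rfl fun k _ => Finset.sum_congr rfl fun l _ => by ring)
    (fun i => by simp [hΦ.self_eq_one (hτ.trans ha), Matrix.one_apply])
    ⟨hb, le_rfl⟩ i
  rw [Matrix.mul_apply]
  simp only [mul_comm (Φ b a i _)]
  linarith

end IsStateTransitionMatrix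

lemma IsGeneratorFamily.diag_eq (hA : IsGeneratorFamily A) (s : ℝ) (i : Fin n) :
    -A s i i = ∑ j ∈ Finset.univ.erase i, A s i j := by
  have h := hA.row_sum s i
  rw [← Finset.add_sum_erase _ _ (Finset.mem_univ i)] at h
  linarith

lemma IsGeneratorFamily.diag_nonneg (hA : IsGeneratorFamily A) (s : ℝ) (i : Fin n) :
    0 ≤ -A s i i := by
  rw [hA.diag_eq]
  exact Finset.sum_nonneg fun j hj => hA.offDiag_nonneg s i j (Finset.ne_of_mem_erase hj).symm

lemma IsGeneratorFamily.integral_diag_le (hA : IsGeneratorFamily A) {K : ℝ} (hK : 0 ≤ K)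
    (hAK : ∀ i j, i ≠ j → ∫ s in a..b, A s i j ≤ K) (i : Fin n) :
    ∫ s in a..b, -A s i i ≤ n * K := by
  simp_rw [hA.diag_eq]
  rw [intervalIntegral.integral_finsetSum fun j _ => hA.integrable i j a b]
  calc ∑ j ∈ Finset.univ.erase i, ∫ s in a..b, A s i j
      ≤ ∑ j ∈ Finset.univ.erase i, K :=
        Finset.sum_le_sum fun j hj => hAK i j (Finset.ne_of_mem_erase hj).symm
    _ ≤ ∑ j : Fin n, K :=
        Finset.sum_le_sum_of_subset_of_nonneg (Finset.erase_subset _ _) fun _ _ _ => hK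
    _ = n * K := by simp

lemma IsGeneratorFamily.integral_mono (hA : IsGeneratorFamily A) {i j : Fin n} (hij : i ≠ j)
    {c d : ℝ} (hac : a ≤ c) (hcd : c ≤ d) (hdb : d ≤ b) :
    ∫ s in c..d, A s i j ≤ ∫ s in a..b, A s i j :=
  intervalIntegral.integral_mono_interval hac hcd hdb
    (Filter.Eventually.of_forall fun s => hA.offDiag_nonneg s i j hij) (hA.integrable i j a b)

lemma IsGeneratorFamily.intervalIntegrable_cutSum (hA : IsGeneratorFamily A) (S : Finset (Fin n))
    (a b : ℝ) : IntervalIntegrable (fun s => cutSum (A s) S) MeasureTheory.volume a b :=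
  intervalIntegrable_fun_sum _ fun i _ => intervalIntegrable_fun_sum _ fun j _ =>
    hA.integrable i j a b

lemma IsGeneratorFamily.cutSum_nonneg (hA : IsGeneratorFamily A) (S : Finset (Fin n)) (s : ℝ) :
    0 ≤ cutSum (A s) S :=
  Finset.sum_nonneg fun i hi => Finset.sum_nonneg fun j hj =>
    hA.offDiag_nonneg s i j fun h => Finset.mem_compl.1 hj (h ▸ hi)

namespace IsStateTransitionMatrix

lemma exp_le_diag (hA : IsGeneratorFamily A) (hΦ : IsStateTransitionMatrix A Φ) (ha : 0 ≤ a)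
    (hab : a ≤ b) {K : ℝ} (hK : 0 ≤ K) (hAK : ∀ i j, i ≠ j → ∫ s in a..b, A s i j ≤ K)
    (i : Fin n) : Real.exp (-(n * K)) ≤ Φ b a i i := by
  have h := (hΦ.isPrimitiveOn ha hab i i).exp_mul_le hab (d := fun s => -A s i i)
    (g := fun _ => 0) (hA.integrable i i a b).neg (by simp) (fun s _ => hA.diag_nonneg s i)
    (fun _ _ => le_rfl) (fun s hs => by
      rw [← Finset.add_sum_erase _ _ (Finset.mem_univ i)]
      have h1 : 0 ≤ ∑ k ∈ Finset.univ.erase i, A s i k * Φ s a k i :=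
        Finset.sum_nonneg fun k hk => mul_nonneg
          (hA.offDiag_nonneg s i k (Finset.ne_of_mem_erase hk).symm) (hΦ.nonneg hA ha hs.1 k i)
      linarith)
  rw [hΦ.self_eq_one ha, Matrix.one_apply_eq, intervalIntegral.integral_zero, add_zero,
    mul_one] at h
  refine le_trans (Real.exp_le_exp.2 (neg_le_neg ?_)) h
  exact hA.integral_diag_le hK hAK i

lemma exp_mul_integral_le (hA : IsGeneratorFamily A) (hΦ : IsStateTransitionMatrix A Φ)
    (ha : 0 ≤ a) (hab : a ≤ b) {K : ℝ} (hK : 0 ≤ K)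
    (hAK : ∀ i j, i ≠ j → ∫ s in a..b, A s i j ≤ K) {i j : Fin n} (hij : i ≠ j) :
    Real.exp (-(2 * (n * K))) * ∫ s in a..b, A s i j ≤ Φ b a i j := by
  have h := (hΦ.isPrimitiveOn ha hab i j).exp_mul_le hab (d := fun s => -A s i i)
    (g := fun s => Real.exp (-(n * K)) * A s i j) (hA.integrable i i a b).neg
    ((hA.integrable i j a b).const_mul _) (fun s _ => hA.diag_nonneg s i)
    (fun s _ => mul_nonneg (Real.exp_pos _).le (hA.offDiag_nonneg s i j hij)) (fun s hs => by
      rw [← Finset.add_sum_erase _ _ (Finset.mem_univ i),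
        ← Finset.add_sum_erase _ _ (Finset.mem_erase.2 ⟨hij.symm, Finset.mem_univ j⟩)]
      have h1 : 0 ≤ ∑ k ∈ (Finset.univ.erase i).erase j, A s i k * Φ s a k j :=
        Finset.sum_nonneg fun k hk => mul_nonneg (hA.offDiag_nonneg s i k
          (Finset.ne_of_mem_erase (Finset.mem_of_mem_erase hk)).symm) (hΦ.nonneg hA ha hs.1 k j)
      have h2 := hΦ.exp_le_diag hA ha hs.1 hK
        (fun i j hij => (hA.integral_mono hij le_rfl hs.1 hs.2).trans (hAK i j hij)) j
      have h3 := mul_le_mul_of_nonneg_left h2 (hA.offDiag_nonneg s i j hij)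
      linarith)
  rw [hΦ.self_eq_one ha, Matrix.one_apply_ne hij, zero_add,
    intervalIntegral.integral_const_mul] at h
  refine le_trans ?_ h
  have h0 : 0 ≤ ∫ s in a..b, A s i j :=
    intervalIntegral.integral_nonneg hab fun s _ => hA.offDiag_nonneg s i j hij
  have h1 : Real.exp (-(2 * (n * K))) = Real.exp (-(n * K)) * Real.exp (-(n * K)) := by
    rw [← Real.exp_add]
    ring_nf
  rw [h1, mul_assoc]
  refine mul_le_mul_of_nonneg_right (Real.exp_le_exp.2 (neg_le_neg ?_)) (by positivity)
  exact hA.integral_diag_le hK hAK i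

lemma exp_mul_integral_cutSum_le (hA : IsGeneratorFamily A) (hΦ : IsStateTransitionMatrix A Φ)
    (ha : 0 ≤ a) (hab : a ≤ b) {K : ℝ} (hK : 0 ≤ K)
    (hAK : ∀ i j, i ≠ j → ∫ s in a..b, A s i j ≤ K) (S : Finset (Fin n)) :
    Real.exp (-(2 * (n * K))) * ∫ s in a..b, cutSum (A s) S ≤ cutSum (Φ b a) S := by
  unfold cutSum
  rw [intervalIntegral.integral_finsetSum fun i _ => intervalIntegrable_fun_sum _ fun j _ =>
    hA.integrable i j a b, Finset.mul_sum]
  refine Finset.sum_le_sum fun i hi => ?_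
  rw [intervalIntegral.integral_finsetSum fun j _ => hA.integrable i j a b, Finset.mul_sum]
  exact Finset.sum_le_sum fun j hj => hΦ.exp_mul_integral_le hA ha hab hK hAK
    fun h => Finset.mem_compl.1 hj (h ▸ hi)

/-- The probability of a transition out of `S` is at most the integrated weight leaving `S`. If that
integral is at most `1`, then `i ↦ 1 - ∫ cutSum`, set to `0` off `S`, is a subsolution that lies
below the probability of being in `S`. -/
lemma sum_compl_le_integral_cutSum (hA : IsGeneratorFamily A) (hΦ : IsStateTransitionMatrix A Φ)
    (ha : 0 ≤ a) (hab : a ≤ b) {S : Finset (Fin n)} {i : Fin n} (hi : i ∈ S) :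
    ∑ j ∈ Sᶜ, Φ b a i j ≤ ∫ s in a..b, cutSum (A s) S := by
  have hrow := hΦ.row_sum hA ha hab i
  rw [← Finset.sum_add_sum_compl S] at hrow
  rcases le_total 1 (∫ s in a..b, cutSum (A s) S) with h1 | h1
  · have h2 : 0 ≤ ∑ j ∈ S, Φ b a i j := Finset.sum_nonneg fun j _ => hΦ.nonneg hA ha hab i j
    linarith
  set c : ℝ → ℝ := fun t => ∫ s in a..t, cutSum (A s) S with hc
  have hcp : IsPrimitiveOn c (fun s => cutSum (A s) S) a b :=
    IsPrimitiveOn.integral (hA.intervalIntegrable_cutSum S a b)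
  have hcle : ∀ s ∈ Set.Icc a b, c s ≤ 1 := fun s hs => by
    refine le_trans ?_ h1
    exact intervalIntegral.integral_mono_interval le_rfl hs.1 hs.2
      (Filter.Eventually.of_forall fun s => hA.cutSum_nonneg S s)
      (hA.intervalIntegrable_cutSum S a b)
  have hc0 : ∀ s ∈ Set.Icc a b, 0 ≤ c s := fun s hs =>
    intervalIntegral.integral_nonneg hs.1 fun s _ => hA.cutSum_nonneg S s
  have h := nonneg_of_supersolution (fun i j => hA.integrable i j a b)
    (fun s _ => hA.offDiag_nonneg s)
    (x := fun i s => ∑ j ∈ S, Φ s a i j - (if i ∈ S then 1 else 0) * (1 - c s))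
    (f := fun i s => ∑ j ∈ S, ∑ k, A s i k * Φ s a k j -
      (if i ∈ S then 1 else 0) * (0 - cutSum (A s) S))
    (fun i => (IsPrimitiveOn.sum S fun j _ => hΦ.isPrimitiveOn ha hab i j).sub
      (((IsPrimitiveOn.const 1 a b).sub hcp).const_mul _))
    (fun s hs k => by
      have e1 : ∑ j, A s k j * (∑ l ∈ S, Φ s a j l - (if j ∈ S then 1 else 0) * (1 - c s)) =
          ∑ l ∈ S, ∑ j, A s k j * Φ s a j l - (∑ j ∈ S, A s k j) * (1 - c s) := by
        simp only [mul_sub, Finset.sum_sub_distrib, Finset.mul_sum]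
        rw [Finset.sum_comm]
        simp [Finset.sum_mul, Finset.sum_ite_mem]
      rw [e1]
      refine sub_le_sub_left ?_ _
      have h2 := hcle s hs
      have h3 := hc0 s hs
      have h4 := hA.cutSum_nonneg S s
      by_cases hk : k ∈ S
      · simp only [hk, if_true, one_mul, zero_sub]
        have e2 := hA.row_sum s k
        rw [← Finset.sum_add_sum_compl S] at e2
        have hnn : ∀ i ∈ S, 0 ≤ ∑ j ∈ Sᶜ, A s i j := fun i hi => Finset.sum_nonneg fun j hj =>
          hA.offDiag_nonneg s i j fun h => Finset.mem_compl.1 hj (h ▸ hi)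
        have e3 : ∑ j ∈ Sᶜ, A s k j ≤ cutSum (A s) S :=
          Finset.single_le_sum (f := fun i => ∑ j ∈ Sᶜ, A s i j) hnn hk
        have e4 := hnn k hk
        nlinarith
      · simp only [hk, if_false, zero_mul]
        refine mul_nonneg (Finset.sum_nonneg fun j hj => hA.offDiag_nonneg s k j ?_) (by linarith)
        exact fun h => hk (h ▸ hj))
    (fun k => by
      simp only [hc, hΦ.self_eq_one ha, Matrix.one_apply, intervalIntegral.integral_same]
      by_cases hk : k ∈ S <;> simp [hk])
    ⟨hab, le_rfl⟩ i
  simp only [hi, if_true, one_mul, hc] at h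
  linarith

lemma cutSum_le (hA : IsGeneratorFamily A) (hΦ : IsStateTransitionMatrix A Φ)
    (ha : 0 ≤ a) (hab : a ≤ b) (S : Finset (Fin n)) :
    cutSum (Φ b a) S ≤ n * ∫ s in a..b, cutSum (A s) S := by
  have h0 : 0 ≤ ∫ s in a..b, cutSum (A s) S :=
    intervalIntegral.integral_nonneg hab fun s _ => hA.cutSum_nonneg S s
  calc cutSum (Φ b a) S ≤ ∑ i ∈ S, ∫ s in a..b, cutSum (A s) S :=
        Finset.sum_le_sum fun i hi => hΦ.sum_compl_le_integral_cutSum hA ha hab hi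
    _ ≤ ∑ i : Fin n, ∫ s in a..b, cutSum (A s) S :=
        Finset.sum_le_sum_of_subset_of_nonneg (Finset.subset_univ _) fun _ _ _ => h0
    _ = n * ∫ s in a..b, cutSum (A s) S := by simp

end IsStateTransitionMatrix

end

/-! ### Absolute probability sequences and reciprocity -/

section

variable {n : ℕ} {A : ℝ → Matrix (Fin n) (Fin n) ℝ} {Φ : ℝ → ℝ → Matrix (Fin n) (Fin n) ℝ}
  {t : ℕ → ℝ}

/-- The intervals `[0, t 0]` and `[t 0, t 1]`, on which no bound is assumed, can be included because
there are finitely many of them. -/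
lemma UniformBoundOnIntegralWeights.exists_bound
    (ht : UniformBoundOnIntegralWeights A t) : ∃ K : ℝ, 0 ≤ K ∧
      (∀ i j, i ≠ j → ∫ s in 0..t 0, A s i j ≤ K) ∧
      ∀ k i j, i ≠ j → ∫ s in t k..t (k + 1), A s i j ≤ K := by
  obtain ⟨M, hM⟩ := ht.bound
  have hsum : ∀ (a b : ℝ) i j, ∫ s in a..b, A s i j ≤
      entrySum (Matrix.of fun i j => ∫ s in a..b, A s i j) := fun a b i j =>
    (le_abs_self _).trans ((Finset.single_le_sum
      (f := fun j => |(Matrix.of fun i j => ∫ s in a..b, A s i j) i j|)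
      (fun _ _ => abs_nonneg _) (Finset.mem_univ j)).trans (sum_abs_row_le_entrySum _ i))
  have h0 := entrySum_nonneg (Matrix.of fun i j => ∫ s in 0..t 0, A s i j)
  have h1 := entrySum_nonneg (Matrix.of fun i j => ∫ s in t 0..t 1, A s i j)
  refine ⟨|M| + entrySum (Matrix.of fun i j => ∫ s in 0..t 0, A s i j) +
    entrySum (Matrix.of fun i j => ∫ s in t 0..t 1, A s i j), by positivity,
    fun i j _ => ?_, fun k i j hij => ?_⟩
  · have := hsum 0 (t 0) i j
    have := abs_nonneg M
    linarith
  · rcases Nat.eq_zero_or_pos k with rfl | hk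
    · have := hsum (t 0) (t 1) i j
      have := abs_nonneg M
      simp only [zero_add]
      linarith
    · have := hM k hk i j hij
      have := le_abs_self M
      linarith

/-- The balance of `π` over `S` on one time interval: the mass that the backward evolution of `π`
carries out of `S` is the mass carried into `S` plus the change of the mass of `S`. -/
lemma IsAbsoluteProbabilitySequence.mul_cutSum_le (hA : IsGeneratorFamily A)
    (hΦ : IsStateTransitionMatrix A Φ) {π : ℝ → Fin n → ℝ}
    (hπ : IsAbsoluteProbabilitySequence Φ π) {p : ℝ} (hp : ∀ t, 0 ≤ t → ∀ i, p ≤ π t i)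
    {a b : ℝ} (ha : 0 ≤ a) (hab : a ≤ b) (S : Finset (Fin n)) :
    p * cutSum (Φ b a) S ≤ ∑ i ∈ S, π b i - ∑ i ∈ S, π a i + cutSum (Φ b a) Sᶜ := by
  have hb : 0 ≤ b := ha.trans hab
  have hinv : ∑ j ∈ S, π a j = ∑ i, π b i * ∑ j ∈ S, Φ b a i j := by
    simp_rw [← hπ.invariant b a ha hab, Matrix.vecMul, dotProduct, Finset.mul_sum]
    exact Finset.sum_comm
  rw [← Finset.sum_add_sum_compl S] at hinv
  have hin : ∑ i ∈ S, π b i * ∑ j ∈ S, Φ b a i j =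
      ∑ i ∈ S, π b i - ∑ i ∈ S, π b i * ∑ j ∈ Sᶜ, Φ b a i j := by
    rw [← Finset.sum_sub_distrib]
    refine Finset.sum_congr rfl fun i _ => ?_
    have := hΦ.row_sum hA ha hab i
    rw [← Finset.sum_add_sum_compl S] at this
    rw [← eq_sub_iff_add_eq] at this
    rw [this]
    ring
  have hout : p * cutSum (Φ b a) S ≤ ∑ i ∈ S, π b i * ∑ j ∈ Sᶜ, Φ b a i j := by
    rw [cutSum, Finset.mul_sum]
    exact Finset.sum_le_sum fun i _ => mul_le_mul_of_nonneg_right (hp b hb i)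
      (Finset.sum_nonneg fun j _ => hΦ.nonneg hA ha hab i j)
  have hle1 : ∀ i, π b i ≤ 1 := fun i => by
    rw [← (hπ.stochastic b hb).2]
    exact Finset.single_le_sum (fun j _ => (hπ.stochastic b hb).1 j) (Finset.mem_univ i)
  have hcompl : ∑ i ∈ Sᶜ, π b i * ∑ j ∈ S, Φ b a i j ≤ cutSum (Φ b a) Sᶜ := by
    rw [cutSum, compl_compl]
    exact Finset.sum_le_sum fun i _ => mul_le_of_le_one_left
      (Finset.sum_nonneg fun j _ => hΦ.nonneg hA ha hab i j) (hle1 i)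
  linarith

lemma IsGeneratorFamily.sum_integral_cutSum (hA : IsGeneratorFamily A) (t : ℕ → ℝ)
    (S : Finset (Fin n)) {l m : ℕ} (hlm : l ≤ m) :
    ∑ k ∈ Finset.Ico l m, ∫ s in t k..t (k + 1), cutSum (A s) S =
      ∫ s in t l..t m, cutSum (A s) S :=
  intervalIntegral.sum_integral_adjacent_intervals_Ico hlm fun _ _ =>
    hA.intervalIntegrable_cutSum S _ _

lemma IsGeneratorFamily.isApproximatelyReciprocal (hn : 0 < n) (hA : IsGeneratorFamily A)
    (ht : UniformBoundOnIntegralWeights A t)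
    (h : HasUniformlyPositiveAbsoluteProbabilitySequence A) : IsApproximatelyReciprocal A t := by
  obtain ⟨Φ, hΦ, π, hπ, p, hp, hpπ⟩ := h
  obtain ⟨K, hK, -, hAK⟩ := ht.exists_bound
  set κ := Real.exp (-(2 * (n * K))) with hκ
  have hκ0 : 0 < κ := Real.exp_pos _
  have hn' : (0 : ℝ) < n := by exact_mod_cast hn
  refine ⟨p * κ / n, 1 / n, by positivity, by positivity, fun S l m hlm => ?_⟩
  have hstep : ∀ k, p * κ * ∫ s in t k..t (k + 1), cutSum (A s) S ≤
      (∑ i ∈ S, π (t (k + 1)) i - ∑ i ∈ S, π (t k) i) +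
        n * ∫ s in t k..t (k + 1), cutSum (A s) Sᶜ := by
    intro k
    have hab : t k ≤ t (k + 1) := ht.strictMono.monotone k.le_succ
    have h1 := hΦ.exp_mul_integral_cutSum_le hA (ht.nonneg k) hab hK (hAK k) S
    have h2 := hπ.mul_cutSum_le hA hΦ hpπ (ht.nonneg k) hab S
    have h3 := hΦ.cutSum_le hA (ht.nonneg k) hab Sᶜ
    have h4 := mul_le_mul_of_nonneg_left h1 hp.le
    linarith
  have hsum := Finset.sum_le_sum fun k (_ : k ∈ Finset.Ico l m) => hstep k
  rw [Finset.sum_add_distrib, Finset.sum_Ico_sub (fun k => ∑ i ∈ S, π (t k) i) hlm, ← Finset.mul_sum,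
    ← Finset.mul_sum, hA.sum_integral_cutSum t S hlm, hA.sum_integral_cutSum t Sᶜ hlm] at hsum
  have hst := hπ.stochastic
  have h1 : ∑ i ∈ S, π (t m) i ≤ 1 := by
    rw [← (hst _ (ht.nonneg m)).2]
    exact Finset.sum_le_sum_of_subset_of_nonneg (Finset.subset_univ S)
      fun i _ _ => (hst _ (ht.nonneg m)).1 i
  have h2 : 0 ≤ ∑ i ∈ S, π (t l) i := Finset.sum_nonneg fun i _ => (hst _ (ht.nonneg l)).1 i
  calc p * κ / n * ∫ s in t l..t m, cutSum (A s) S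
      = (p * κ * ∫ s in t l..t m, cutSum (A s) S) / n := by ring
    _ ≤ (1 + n * ∫ s in t l..t m, cutSum (A s) Sᶜ) / n := by
        refine div_le_div_of_nonneg_right ?_ hn'.le
        linarith
    _ = (∫ s in t l..t m, cutSum (A s) Sᶜ) + 1 / n := by field_simp; ring

/-- Under approximate reciprocity the column sums of the transition matrices between the times `t l`
and `t m` are bounded away from zero, uniformly in `l` and `m`. -/
lemma IsStateTransitionMatrix.exists_column_sum_bound (hn : 0 < n) (hA : IsGeneratorFamily A)
    (hΦ : IsStateTransitionMatrix A Φ) (ht : UniformBoundOnIntegralWeights A t)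
    (h : IsApproximatelyReciprocal A t) :
    ∃ c : ℝ, 0 < c ∧ ∀ l m, l ≤ m → ∀ j, c ≤ ∑ i, Φ (t m) (t l) i j := by
  obtain ⟨p₀, β, hp₀, hβ, hrec⟩ := h
  obtain ⟨K, hK, -, hAK⟩ := ht.exists_bound
  set κ := Real.exp (-(2 * (n * K))) with hκ
  have hκ0 : 0 < κ := Real.exp_pos _
  have hn' : (0 : ℝ) < n := by exact_mod_cast hn
  have hmono : ∀ k, t k ≤ t (k + 1) := fun k => ht.strictMono.monotone k.le_succ
  obtain ⟨c, hc, hmass⟩ := exists_uniform_mass_bound (p₀ := p₀ * κ / n)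
    (γ := Real.exp (-(n * K))) (by positivity) (Real.exp_pos _) n (β * κ) 0 (by positivity) le_rfl
  refine ⟨c, hc, fun l m hlm j => ?_⟩
  set B : ℕ → Matrix (Fin n) (Fin n) ℝ := fun k => Φ (t (k + 1)) (t k) with hB
  have hB0 : ∀ k i j, 0 ≤ B k i j := fun k i j => hΦ.nonneg hA (ht.nonneg k) (hmono k) i j
  have hBrow : ∀ k i, ∑ j, B k i j = 1 := fun k i => hΦ.row_sum hA (ht.nonneg k) (hmono k) i
  have hBrec : IsReciprocalOn (p₀ * κ / n) (Real.exp (-(n * K))) (β * κ) 0 B Finset.univ l m := by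
    refine ⟨hB0, fun k _ i _ => hΦ.exp_le_diag hA (ht.nonneg k) (hmono k) hK (hAK k) i,
      fun k _ i _ => (hBrow k i).le, by simp [hBrow], fun S _ r s _ hrs _ => ?_⟩
    rw [← Finset.compl_eq_univ_sdiff]
    have h1 : ∑ k ∈ Finset.Ico r s, blockSum (B k) S Sᶜ ≤ n * ∫ u in t r..t s, cutSum (A u) S := by
      rw [← hA.sum_integral_cutSum t S hrs, Finset.mul_sum]
      exact Finset.sum_le_sum fun k _ => hΦ.cutSum_le hA (ht.nonneg k) (hmono k) S
    have h2 : κ * ∫ u in t r..t s, cutSum (A u) Sᶜ ≤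
        ∑ k ∈ Finset.Ico r s, blockSum (B k) Sᶜ S := by
      rw [← hA.sum_integral_cutSum t Sᶜ hrs, Finset.mul_sum]
      refine Finset.sum_le_sum fun k _ => ?_
      have := hΦ.exp_mul_integral_cutSum_le hA (ht.nonneg k) (hmono k) hK (hAK k) Sᶜ
      rwa [cutSum, compl_compl] at this
    have h3 := mul_le_mul_of_nonneg_left (hrec S r s hrs) hκ0.le
    calc p₀ * κ / n * ∑ k ∈ Finset.Ico r s, blockSum (B k) S Sᶜ
        ≤ p₀ * κ / n * (n * ∫ u in t r..t s, cutSum (A u) S) :=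
          mul_le_mul_of_nonneg_left h1 (by positivity)
      _ = κ * (p₀ * ∫ u in t r..t s, cutSum (A u) S) := by field_simp
      _ ≤ _ := by linarith
  have hsup : IsSupersolutionOn B Finset.univ l m
      (fun r i => if l ≤ r then Φ (t r) (t l) i j else 0) := by
    refine ⟨fun r i => ?_, fun r hr i _ => ?_⟩
    · split_ifs with hlr
      · exact hΦ.nonneg hA (ht.nonneg l) (ht.strictMono.monotone hlr) i j
      · exact le_rfl
    · have hlr : l ≤ r := (Finset.mem_Ico.1 hr).1
      simp only [hlr, hlr.trans r.le_succ, if_true]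
      rw [← hΦ.mul_eq hA (ht.nonneg l) (ht.strictMono.monotone hlr) (hmono r), Matrix.mul_apply]
  have := hmass B Finset.univ (by simp) l m hlm hBrec _ hsup j (Finset.mem_univ j)
  simpa [hlm, hΦ.self_eq_one (ht.nonneg l)] using this

lemma IsStateTransitionMatrix.exists_eventually_column_sum_bound (hn : 0 < n)
    (hA : IsGeneratorFamily A) (hΦ : IsStateTransitionMatrix A Φ)
    (ht : UniformBoundOnIntegralWeights A t) (h : IsApproximatelyReciprocal A t) :
    ∃ c : ℝ, 0 < c ∧ ∀ τ, 0 ≤ τ → ∀ j, ∀ᶠ m in Filter.atTop, c ≤ ∑ i, Φ (t m) τ i j := by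
  obtain ⟨c, hc, hcol⟩ := hΦ.exists_column_sum_bound hn hA ht h
  obtain ⟨K, hK, hK0, hAK⟩ := ht.exists_bound
  refine ⟨c * Real.exp (-(n * K)), by positivity, fun τ hτ j => ?_⟩
  have hex : ∃ k, τ ≤ t k := (ht.tendsto.eventually_ge_atTop τ).exists
  obtain ⟨k, hτk, hdiag⟩ : ∃ k, τ ≤ t k ∧ Real.exp (-(n * K)) ≤ Φ (t k) τ j j := by
    classical
    refine ⟨Nat.find hex, Nat.find_spec hex,
      hΦ.exp_le_diag hA hτ (Nat.find_spec hex) hK (fun i j hij => ?_) j⟩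
    have hmin := fun q (hq : q < Nat.find hex) => Nat.find_min hex hq
    have hspec := Nat.find_spec hex
    generalize Nat.find hex = k at hmin hspec
    rcases k with - | k
    · exact (hA.integral_mono hij hτ hspec le_rfl).trans (hK0 i j hij)
    · exact (hA.integral_mono hij (not_le.1 (hmin k k.lt_succ_self)).le hspec le_rfl).trans
        (hAK k i j hij)
  filter_upwards [Filter.eventually_ge_atTop k] with m hkm
  have hkm' := ht.strictMono.monotone hkm
  calc c * Real.exp (-(n * K)) ≤ (∑ i, Φ (t m) (t k) i j) * Φ (t k) τ j j :=
        mul_le_mul (hcol k m hkm j) hdiag (Real.exp_pos _).le (hc.le.trans (hcol k m hkm j))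
    _ ≤ ∑ i, Φ (t m) τ i j := by
        rw [Finset.sum_mul]
        refine Finset.sum_le_sum fun i _ => ?_
        rw [← hΦ.mul_eq hA hτ hτk hkm', Matrix.mul_apply]
        exact Finset.single_le_sum (f := fun l => Φ (t m) (t k) i l * Φ (t k) τ l j)
          (fun l _ => mul_nonneg (hΦ.nonneg hA (ht.nonneg k) hkm' i l) (hΦ.nonneg hA hτ hτk l j))
          (Finset.mem_univ j)

/-- The absolute probability sequence is a limit along an ultrafilter of the backward evolutions of
the uniform distribution at the times `t m`. -/
lemma IsGeneratorFamily.hasUniformlyPositiveAbsoluteProbabilitySequence (hn : 0 < n)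
    (hA : IsGeneratorFamily A) (ht : UniformBoundOnIntegralWeights A t)
    (h : IsApproximatelyReciprocal A t) : HasUniformlyPositiveAbsoluteProbabilitySequence A := by
  obtain ⟨Φ, hΦ⟩ := hA.exists_stateTransitionMatrix
  obtain ⟨c, hc, hcol⟩ := hΦ.exists_eventually_column_sum_bound hn hA ht h
  have hn' : (0 : ℝ) < n := by exact_mod_cast hn
  set u : ℝ → Fin n → ℕ → ℝ := fun τ j m => (∑ i, Φ (t m) τ i j) / n with hu
  have hev : ∀ τ, ∀ᶠ m in (Filter.hyperfilter ℕ : Filter ℕ), τ ≤ t m := fun τ =>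
    Nat.hyperfilter_le_atTop (ht.tendsto.eventually_ge_atTop τ)
  have hlim : ∀ τ j, ∃ L, 0 ≤ τ → Filter.Tendsto (u τ j) (Filter.hyperfilter ℕ) (nhds L) := by
    intro τ j
    by_cases hτ : 0 ≤ τ
    · have hmem : ∀ᶠ m in (Filter.hyperfilter ℕ : Filter ℕ), u τ j m ∈ Set.Icc (0 : ℝ) 1 := by
        filter_upwards [hev τ] with m hm
        refine ⟨div_nonneg (Finset.sum_nonneg fun i _ => hΦ.nonneg hA hτ hm i j) hn'.le, ?_⟩
        rw [hu, div_le_one hn']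
        calc ∑ i, Φ (t m) τ i j ≤ ∑ i : Fin n, (1 : ℝ) := Finset.sum_le_sum fun i _ => by
              rw [← hΦ.row_sum hA hτ hm i]
              exact Finset.single_le_sum (fun l _ => hΦ.nonneg hA hτ hm i l) (Finset.mem_univ j)
          _ = n := by simp
      obtain ⟨L, -, hL⟩ := isCompact_Icc.ultrafilter_le_nhds
        ((Filter.hyperfilter ℕ).map (u τ j)) (Filter.le_principal_iff.2 hmem)
      exact ⟨L, fun _ => hL⟩
    · exact ⟨0, fun h' => absurd h' hτ⟩
  choose π hπ using hlim
  have hpos : ∀ τ, 0 ≤ τ → ∀ j, c / n ≤ π τ j := fun τ hτ j => by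
    refine ge_of_tendsto (hπ τ j hτ) ?_
    filter_upwards [Nat.hyperfilter_le_atTop (hcol τ hτ j)] with m hm
    exact div_le_div_of_nonneg_right hm hn'.le
  refine ⟨Φ, hΦ, π, ⟨fun τ hτ => ⟨fun j => le_trans (by positivity) (hpos τ hτ j), ?_⟩,
    fun b a ha hab => ?_⟩, c / n, by positivity, hpos⟩
  · have h1 := tendsto_finsetSum Finset.univ fun j (_ : j ∈ Finset.univ) => hπ τ j hτ
    refine tendsto_nhds_unique (h1.congr' ?_) tendsto_const_nhds
    filter_upwards [hev τ] with m hm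
    rw [hu, ← Finset.sum_div, Finset.sum_comm]
    simp only [hΦ.row_sum hA hτ hm]
    simp [hn'.ne']
  · ext j
    rw [Matrix.vecMul, dotProduct]
    have h1 := tendsto_finsetSum Finset.univ fun i (_ : i ∈ Finset.univ) =>
      (hπ b i (ha.trans hab)).mul_const (Φ b a i j)
    refine tendsto_nhds_unique (h1.congr' ?_) (hπ a j ha)
    filter_upwards [hev b] with m hm
    simp only [hu, ← hΦ.mul_eq hA ha hab hm, Matrix.mul_apply]
    rw [Finset.sum_comm, Finset.sum_div]
    refine Finset.sum_congr rfl fun i _ => ?_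
    rw [← Finset.sum_mul]
    ring

/-! ### Independence of the values at nonpositive times -/

lemma intervalIntegral_congr_pos {f g : ℝ → ℝ} {a b : ℝ} (ha : 0 ≤ a) (hab : a ≤ b)
    (h : ∀ s, 0 < s → f s = g s) : ∫ s in a..b, f s = ∫ s in a..b, g s := by
  refine intervalIntegral.integral_congr_ae (Filter.Eventually.of_forall fun s hs => h s ?_)
  rw [Set.uIoc_of_le hab] at hs
  exact ha.trans_lt hs.1

variable {A' : ℝ → Matrix (Fin n) (Fin n) ℝ}

lemma IsStateTransitionMatrix.congr_pos (h : ∀ s, 0 < s → A s = A' s)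
    (hΦ : IsStateTransitionMatrix A Φ) : IsStateTransitionMatrix A' Φ := by
  intro b a ha hab i j
  obtain ⟨h1, h2⟩ := hΦ b a ha hab i j
  refine ⟨h1.congr fun s hs => ?_, ?_⟩
  · rw [Set.uIoc_of_le hab] at hs
    simp only [h s (ha.trans_lt hs.1)]
  · rw [h2, intervalIntegral_congr_pos ha hab fun s hs => by rw [h s hs]]

lemma HasUniformlyPositiveAbsoluteProbabilitySequence.congr_pos (h : ∀ s, 0 < s → A s = A' s)
    (hA : HasUniformlyPositiveAbsoluteProbabilitySequence A) :
    HasUniformlyPositiveAbsoluteProbabilitySequence A' :=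
  let ⟨Φ, hΦ, hrest⟩ := hA
  ⟨Φ, hΦ.congr_pos h, hrest⟩

lemma UniformBoundOnIntegralWeights.congr_pos (h : ∀ s, 0 < s → A s = A' s)
    (hA : UniformBoundOnIntegralWeights A t) : UniformBoundOnIntegralWeights A' t := by
  refine ⟨hA.nonneg, hA.strictMono, hA.tendsto, ?_⟩
  obtain ⟨M, hM⟩ := hA.bound
  refine ⟨M, fun k hk i j hij => ?_⟩
  rw [← intervalIntegral_congr_pos (f := fun s => A s i j) (hA.nonneg k) (hA.strictMono.monotone k.le_succ)
    fun s hs => by rw [h s hs]]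
  exact hM k hk i j hij

lemma IsApproximatelyReciprocal.congr_pos (h : ∀ s, 0 < s → A s = A' s) (ht0 : ∀ k, 0 ≤ t k)
    (ht : StrictMono t) (hA : IsApproximatelyReciprocal A t) : IsApproximatelyReciprocal A' t := by
  obtain ⟨p₀, β, hp₀, hβ, hrec⟩ := hA
  refine ⟨p₀, β, hp₀, hβ, fun S l m hlm => ?_⟩
  have := hrec S l m hlm
  rwa [intervalIntegral_congr_pos (f := fun s => cutSum (A s) S)
      (g := fun s => cutSum (A' s) S) (ht0 l) (ht.monotone hlm)
      fun s hs => by rw [h s hs],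
    intervalIntegral_congr_pos (f := fun s => cutSum (A s) Sᶜ)
      (g := fun s => cutSum (A' s) Sᶜ) (ht0 l) (ht.monotone hlm)
      fun s hs => by rw [h s hs]] at this

/-- Extending a chain by `0` to nonpositive times gives a generator family. It agrees with the chain at
all positive times, which is all that integrals over intervals in `[0, ∞)` depend on. -/
lemma IsContinuousTimeStochasticChain.isGeneratorFamily (hA : IsContinuousTimeStochasticChain A) :
    IsGeneratorFamily fun s => if 0 < s then A s else 0 := by
  refine ⟨fun s i j hij => ?_, fun s i => ?_, fun i j => ?_⟩
  · split_ifs with hs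
    · obtain ⟨W, hW, hAW⟩ := hA.neg_laplacian s hs.le
      simpa [hAW, weightedLaplacian, hij] using hW i j
    · simp
  · split_ifs with hs
    · obtain ⟨W, hW, hAW⟩ := hA.neg_laplacian s hs.le
      rw [← Finset.add_sum_erase _ _ (Finset.mem_univ i)]
      have h1 : ∑ j ∈ Finset.univ.erase i, A s i j = ∑ j ∈ Finset.univ.erase i, W i j :=
        Finset.sum_congr rfl fun j hj => by
          simp [hAW, weightedLaplacian, (Finset.ne_of_mem_erase hj).symm]
      rw [h1]
      simp [hAW, weightedLaplacian]
    · simp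
  · have h0 : ∀ c, IntervalIntegrable (fun s => (if 0 < s then A s else 0) i j)
        MeasureTheory.volume 0 c := by
      intro c
      rcases lt_or_ge 0 c with hc | hc
      · refine (hA.integrable i j 0 c le_rfl hc).congr fun s hs => ?_
        rw [Set.uIoc_of_le hc.le] at hs
        simp [hs.1]
      · refine (intervalIntegrable_const (c := (0 : ℝ))).congr fun s hs => ?_
        rw [Set.uIoc_of_ge hc] at hs
        simp [hs.2.not_gt]
    exact fun a b => (h0 a).symm.trans (h0 b)

end

theorem theorem3 {n : ℕ} (hn : 0 < n) (A : ℝ → Matrix (Fin n) (Fin n) ℝ)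
    (hA : IsContinuousTimeStochasticChain A)
    (t : ℕ → ℝ) (ht : UniformBoundOnIntegralWeights A t) :
    HasUniformlyPositiveAbsoluteProbabilitySequence A ↔ IsApproximatelyReciprocal A t := by
  have hG := hA.isGeneratorFamily
  have heq : ∀ s, 0 < s → A s = if 0 < s then A s else 0 := fun s hs => by simp [hs]
  have heq' : ∀ s, 0 < s → (if 0 < s then A s else 0) = A s := fun s hs => (heq s hs).symm
  have htG := ht.congr_pos heq
  exact ⟨fun h => (hG.isApproximatelyReciprocal hn htG (h.congr_pos heq)).congr_pos heq'
      ht.nonneg ht.strictMono,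
    fun h => (hG.hasUniformlyPositiveAbsoluteProbabilitySequence hn htG
      (h.congr_pos heq ht.nonneg ht.strictMono)).congr_pos heq'⟩
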